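/- Let $A=V/\Lambda$ be a complex Abelian variety with a polarization, i.e. a positive definite Hermitian form $H$ on $V$ whose imaginary part is integral on the lattice $\Lambda$. An elliptic curve in $A$ is a one-dimensional complex subtorus $C=L/(L\cap\Lambda)$; its degree is $|\mathrm{Im}\,H(\lambda,\mu)|$ for a $\mathbb Z$-basis $\lambda,\mu$ of $L\cap\Lambda$ (the degree of the induced polarization). $N_A(t)$ denotes the number of elliptic curves in $A$ of degree $\le t$. A product polarization on a product of elliptic curves is a sum of pullbacks of polarizations of the factors. For an elliptic curve $E$, a curve in $E^n$ is called ordinary if it is the image of $E\to E^n$, $x\mapsto(v_1x,\dots,v_nx)$, for a primitive $v\in\mathbb Z^n$, and extra-ordinary otherwise. Given an isogeny $E^g\to A$ ($g=\dim A$), or an isogeny $E^2\times E'\to A$ with $E,E'$ not isogenous ($\dim A=3$), the (extra-)ordinary elliptic curves in $A$ are the images of those in $E^g$, respectively in $E^2\subset E^2\times E'$. **Surfaces.** Let $\dim A=2$. 1. $N_A(t)$ is finite for every $t$, and $N_A(t)=O(t^3)$ as $t\to\infty$. 2. Every elliptic curve $C$ in $A$ has a complementary elliptic curve $C'$ such that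 there is an isogeny $C\times C'\to A$, embedding the factors onto $C$ and $C'$, which pulls the polarization back to a product polarization. 3. If $A$ contains at least three elliptic curves then, for every isogeny $E\times E'\to A$ with $E,E'$ elliptic curves, $E$ and $E'$ are isogenous; and there is an isogeny $E^2\to A$ with $E$ an elliptic curve such that the induced polarization on $E^2$ is a product polarization. 4. For every isogeny $E^2\to A$ there are infinitely many ordinary elliptic curves in $A$; there is an extra-ordinary one if and only if $E$ has complex multiplication, and there are infinitely many extra-ordinary ones if and only if $E$ has complex multiplication. **Threefolds.** Let $\dim A=3$. 1. $N_A(t)$ is finite for every $t$, and $N_A(t)=O(t^5)$ as $t\to\infty$. 2. If $C\neq C'$ are elliptic curves in $A$, there are an elliptic curve $C''$ in $A$ and an isogeny $C\times C'\times C''\to A$ embedding the factors onto $C,C',C''$. There are also elliptic curves $C_1,C_2$ in $A$ and an isogeny $C\times C_1\times C_2\to A$, embedding the factors onto $C,C_1,C_2$, such that the induced polarization is a product polarization. 3. If $A$ contains at least four elliptic curves then, for every isogeny $E_1\times E_2\times E_3\to A$ with $E_i$ elliptic curves, at least two of the $E_i$ are isogenous; and there is an isogeny $E^3\to A$, or an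 isogeny $E^2\times E'\to A$ with $E,E'$ not isogenous, such that the induced polarization is a product polarization. 4. For every isogeny $E^3\to A$, and for every isogeny $E^2\times E'\to A$ with $E,E'$ not isogenous, there are infinitely many ordinary elliptic curves in $A$; and if there is some extra-ordinary elliptic curve in $A$ then there are infinitely many. -/

import Mathlib

open Asymptotics Filter

/-- A complex torus `V / Λ`: the data is a lattice `Λ` in the complex vector space `V`
(a discrete subgroup that spans `V` over `ℝ`). -/
structure ComplexTorus (V : Type*) [NormedAddCommGroup V] [NormedSpace ℂ V] where
  lattice : Submodule ℤ V
  discrete : DiscreteTopology lattice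
  span_real : Submodule.span ℝ (lattice : Set V) = ⊤

namespace ComplexTorus

section General

variable {U V W : Type*} [NormedAddCommGroup U] [NormedSpace ℂ U]
  [NormedAddCommGroup V] [NormedSpace ℂ V] [NormedAddCommGroup W] [NormedSpace ℂ W]

/-- The group of points `V / Λ`. -/
abbrev Carrier (A : ComplexTorus V) : Type _ := V ⧸ A.lattice

/-! ### Homomorphisms and isogenies -/

/-- A homomorphism of complex tori `V / Λ → W / Λ'`: a complex linear map `V → W` that maps `Λ`
into `Λ'`. -/
structure Hom (A : ComplexTorus V) (B : ComplexTorus W) where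
  lin : V →ₗ[ℂ] W
  map_lattice : A.lattice ≤ B.lattice.comap (lin.restrictScalars ℤ)

/-- The induced homomorphism on points. -/
def Hom.onPoints {A : ComplexTorus V} {B : ComplexTorus W} (f : Hom A B) :
    A.Carrier →ₗ[ℤ] B.Carrier :=
  A.lattice.mapQ B.lattice (f.lin.restrictScalars ℤ) f.map_lattice

/-- Composition of homomorphisms. -/
def Hom.comp {A : ComplexTorus U} {B : ComplexTorus V} {C : ComplexTorus W}
    (g : Hom B C) (f : Hom A B) : Hom A C where
  lin := g.lin ∘ₗ f.lin
  map_lattice := fun _ hx => g.map_lattice (f.map_lattice hx)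

/-- An isogeny: a surjective homomorphism with finite kernel. -/
def Hom.IsIsogeny {A : ComplexTorus V} {B : ComplexTorus W} (f : Hom A B) : Prop :=
  Function.Surjective f.onPoints ∧ Finite (LinearMap.ker f.onPoints)

/-- There is an isogeny between the two tori. -/
def Isogenous (A : ComplexTorus V) (B : ComplexTorus W) : Prop :=
  ∃ f : Hom A B, f.IsIsogeny

/-! ### Polarizations -/

/-- A polarization of `V / Λ`: a positive definite Hermitian form on `V` (linear in the first and
conjugate linear in the second variable) whose imaginary part takes integral values on `Λ`. -/
structure Polarization (A : ComplexTorus V) where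
  form : V →ₗ[ℂ] V →ₗ⋆[ℂ] ℂ
  hermitian : ∀ x y, form y x = (starRingEnd ℂ) (form x y)
  pos : ∀ x, x ≠ 0 → 0 < (form x x).re
  integral : ∀ x ∈ A.lattice, ∀ y ∈ A.lattice, ∃ n : ℤ, (form x y).im = n

/-! ### Elliptic curves in a torus -/

/-- An elliptic curve in `A = V / Λ`, i.e. a one-dimensional complex subtorus: it is given by a
complex line `L` in `V` such that `L ∩ Λ` is a lattice in `L`. -/
structure EllipticCurve (A : ComplexTorus V) where
  line : Submodule ℂ V
  finrank_line : Module.finrank ℂ line = 1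
  span_real : Submodule.span ℝ ((A.lattice : Set V) ∩ line) = line.restrictScalars ℝ

/-- The lattice `L ∩ Λ` of the elliptic curve. -/
def EllipticCurve.lattice {A : ComplexTorus V} (C : A.EllipticCurve) : Submodule ℤ V :=
  A.lattice ⊓ C.line.restrictScalars ℤ

/-- The set of points of the elliptic curve, as a subgroup of the points of `A`. -/
def EllipticCurve.carrier {A : ComplexTorus V} (C : A.EllipticCurve) : Submodule ℤ A.Carrier :=
  (C.line.restrictScalars ℤ).map A.lattice.mkQ

/-- An elliptic curve in `A` is determined by its set of points. -/
theorem EllipticCurve.carrier_injective [FiniteDimensional ℂ V] {A : ComplexTorus V} :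
    Function.Injective (EllipticCurve.carrier (A := A)) := by
  have key : ∀ C D : A.EllipticCurve, C.carrier = D.carrier → C.line ≤ D.line := by
    intro C D h v hv
    by_contra hvD
    have := A.discrete
    have : IsZLattice ℝ A.lattice := ⟨A.span_real⟩
    have hc : Countable A.lattice := inferInstance
    have hcov : ∀ r : ℝ, ∃ l : A.lattice, (r : ℂ) • v - (l : V) ∈ D.line := by
      intro r
      have h1 : A.lattice.mkQ ((r : ℂ) • v) ∈ D.carrier := by
        rw [← h]
        exact Submodule.mem_map_of_mem (C.line.smul_mem _ hv)
      obtain ⟨w, hw, hw'⟩ := h1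
      refine ⟨⟨(r : ℂ) • v - w, ?_⟩, ?_⟩
      · rw [Submodule.mkQ_apply, Submodule.mkQ_apply, eq_comm, Submodule.Quotient.eq] at hw'
        exact hw'
      · simpa using hw
    choose l hl using hcov
    have hinj : Function.Injective l := by
      intro r s hrs
      by_contra hne
      have h1 := D.line.sub_mem (hl r) (hl s)
      rw [hrs, sub_sub_sub_cancel_right, ← sub_smul] at h1
      have h2 : ((r : ℂ) - s) ≠ 0 := by
        rw [sub_ne_zero]
        exact_mod_cast hne
      exact hvD ((D.line.smul_mem_iff h2).1 h1)
    have : Countable ℝ := hinj.countable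
    exact not_countable (α := ℝ) this
  intro C D h
  have hl : C.line = D.line := le_antisymm (key C D h) (key D C h.symm)
  cases C
  cases D
  cases hl
  rfl

/-- The lattice of an elliptic curve has rank two. -/
theorem EllipticCurve.exists_basis [FiniteDimensional ℂ V] {A : ComplexTorus V}
    (C : A.EllipticCurve) : Nonempty (Module.Basis (Fin 2) ℤ C.lattice) := by
  have := A.discrete
  have hd : DiscreteTopology C.lattice :=
    DiscreteTopology.of_subset (s := (A.lattice : Set V)) A.discrete
      (fun x hx => hx.1)
  have hs : Submodule.span ℤ (C.lattice : Set V) = C.lattice := Submodule.span_eq _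
  have hd' : DiscreteTopology (Submodule.span ℤ (C.lattice : Set V)) := by rw [hs]; exact hd
  have h := Real.finrank_eq_int_finrank_of_discrete hd'
  have h1 : Module.finrank ℤ C.lattice = 2 := by
    rw [Set.finrank, Set.finrank, hs] at h
    rw [← h]
    have h2 : (C.lattice : Set V) = (A.lattice : Set V) ∩ C.line := rfl
    rw [h2, C.span_real]
    have h3 := finrank_real_of_complex C.line
    rw [C.finrank_line] at h3
    exact h3
  exact ⟨Module.finBasisOfFinrankEq ℤ C.lattice h1⟩

/-- The degree of the elliptic curve `C` with respect to the polarization `P`: the absolute value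
of the alternating form `Im P` at a basis of the lattice of `C`. -/
noncomputable def EllipticCurve.degree [FiniteDimensional ℂ V] {A : ComplexTorus V}
    (C : A.EllipticCurve) (P : A.Polarization) : ℝ :=
  |(P.form (C.exists_basis.some 0 : V) (C.exists_basis.some 1 : V)).im|

/-- The degree can be computed with any basis. -/
theorem EllipticCurve.degree_eq [FiniteDimensional ℂ V] {A : ComplexTorus V}
    (C : A.EllipticCurve) (P : A.Polarization) (b : Module.Basis (Fin 2) ℤ C.lattice) :
    C.degree P = |(P.form (b 0 : V) (b 1 : V)).im| := by
  have hself : ∀ x, (P.form x x).im = 0 := by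
    intro x
    have := congrArg Complex.im (P.hermitian x x)
    rw [Complex.conj_im] at this
    linarith
  have hswap : ∀ x y, (P.form y x).im = -(P.form x y).im := by
    intro x y
    rw [P.hermitian x y, Complex.conj_im]
  have hz1 : ∀ (n : ℤ) (x y : V), (P.form (n • x) y).im = n * (P.form x y).im := by
    intro n x y
    simp
  have hz2 : ∀ (n : ℤ) (x y : V), (P.form x (n • y)).im = n * (P.form x y).im := by
    intro n x y
    simp
  have hle : ∀ b c : Module.Basis (Fin 2) ℤ C.lattice,
      |(P.form (b 0 : V) (b 1 : V)).im| =
        |((b.det c : ℤ) : ℝ)|⁻¹ * |(P.form (c 0 : V) (c 1 : V)).im| := by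
    intro b c
    have hu : IsUnit (b.det c) := b.isUnit_det c
    have h0 : (c 0 : V) = b.repr (c 0) 0 • (b 0 : V) + b.repr (c 0) 1 • (b 1 : V) := by
      have h := congrArg (Subtype.val) (b.sum_repr (c 0))
      rw [Fin.sum_univ_two] at h
      exact h.symm
    have h1 : (c 1 : V) = b.repr (c 1) 0 • (b 0 : V) + b.repr (c 1) 1 • (b 1 : V) := by
      have h := congrArg (Subtype.val) (b.sum_repr (c 1))
      rw [Fin.sum_univ_two] at h
      exact h.symm
    have hdet : b.det c = b.repr (c 0) 0 * b.repr (c 1) 1 - b.repr (c 1) 0 * b.repr (c 0) 1 := by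
      rw [Module.Basis.det_apply, Matrix.det_fin_two]
      simp [Module.Basis.toMatrix_apply]
    have hval : (P.form (c 0 : V) (c 1 : V)).im
        = ((b.det c : ℤ) : ℝ) * (P.form (b 0 : V) (b 1 : V)).im := by
      rw [h0, h1, hdet]
      simp only [map_add, LinearMap.add_apply, Complex.add_im, hz1, hz2, hself,
        hswap (b 0 : V) (b 1 : V)]
      push_cast
      ring
    rw [hval, abs_mul, ← mul_assoc, inv_mul_cancel₀, one_mul]
    simpa using hu.ne_zero
  have hunit : ∀ b c : Module.Basis (Fin 2) ℤ C.lattice, |((b.det c : ℤ) : ℝ)| = 1 := by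
    intro b c
    have := Int.isUnit_iff_abs_eq.1 (b.isUnit_det c)
    exact_mod_cast this
  rw [EllipticCurve.degree, hle _ b, hunit, inv_one, one_mul]

/-- The elliptic curves in `A` of degree at most `t`. -/
def curvesOfDegreeLE [FiniteDimensional ℂ V] (A : ComplexTorus V) (P : A.Polarization) (t : ℝ) :
    Set A.EllipticCurve :=
  {C | C.degree P ≤ t}

/-- The counting function `N_A(t)`. -/
noncomputable def curveCount [FiniteDimensional ℂ V] (A : ComplexTorus V) (P : A.Polarization)
    (t : ℝ) : ℕ :=
  (A.curvesOfDegreeLE P t).ncard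

end General

/-! ### Products of elliptic curves -/

/-- The product of the elliptic curves `E i = ℂ / Λ i`, as a complex torus `ℂⁿ / ∏ Λ i`. -/
def pi {n : ℕ} (E : Fin n → ComplexTorus ℂ) : ComplexTorus (Fin n → ℂ) where
  lattice := Submodule.pi Set.univ fun i => (E i).lattice
  discrete := by
    have := fun i => (E i).discrete
    let φ : (Submodule.pi Set.univ fun i => (E i).lattice : Submodule ℤ (Fin n → ℂ)) →
        ∀ i, (E i).lattice := fun x i => ⟨x.1 i, x.2 i (Set.mem_univ i)⟩
    have hφ : Continuous φ := by
      refine continuous_pi fun i => ?_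
      exact ((continuous_apply i).comp continuous_subtype_val).subtype_mk _
    refine DiscreteTopology.of_continuous_injective hφ ?_
    intro x y h
    ext i
    exact congrArg Subtype.val (congrFun h i)
  span_real := by
    rw [eq_top_iff]
    intro x _
    have hx : x = ∑ i, Pi.single i (x i) := (Finset.univ_sum_single x).symm
    rw [hx]
    refine Submodule.sum_mem _ fun i _ => ?_
    have h1 : x i ∈ Submodule.span ℝ ((E i).lattice : Set ℂ) := by
      rw [(E i).span_real]
      trivial
    generalize x i = a at h1
    induction h1 using Submodule.span_induction with
    | mem z hz =>
      refine Submodule.subset_span ?_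
      intro j _
      by_cases hj : j = i
      · subst hj
        simpa using hz
      · simp [Pi.single_eq_of_ne hj]
    | zero => simp
    | add y z _ _ hy hz => rw [Pi.single_add]; exact Submodule.add_mem _ hy hz
    | smul r y _ hy => rw [Pi.single_smul]; exact Submodule.smul_mem _ r hy

/-- The self product `Eⁿ`. -/
abbrev pow (E : ComplexTorus ℂ) (n : ℕ) : ComplexTorus (Fin n → ℂ) := pi fun _ => E

/-- The embedding of the factor `E i` in the product. -/
noncomputable def factor {n : ℕ} (E : Fin n → ComplexTorus ℂ) (i : Fin n) : Hom (E i) (pi E) where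
  lin := LinearMap.single ℂ (fun _ => ℂ) i
  map_lattice := by
    intro z hz j _
    by_cases hj : j = i
    · subst hj
      simpa using hz
    · simp [Pi.single_eq_of_ne hj]

/-- The embedding `E² → E² × E'`, `(x, y) ↦ (x, y, 0)`. -/
noncomputable def inclSq (E E' : ComplexTorus ℂ) : Hom (pow E 2) (pi ![E, E, E']) where
  lin := LinearMap.pi ![LinearMap.proj 0, LinearMap.proj 1, 0]
  map_lattice := by
    intro z hz j _
    have hz0 := hz 0 (Set.mem_univ _)
    have hz1 := hz 1 (Set.mem_univ _)
    fin_cases j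
    · exact hz0
    · exact hz1
    · exact Submodule.zero_mem _

section Product

variable {V : Type*} [NormedAddCommGroup V] [NormedSpace ℂ V]

/-- The pullback of the polarization `P` by a homomorphism `f` from a product of elliptic curves
is a product polarization: it is the sum of the pullbacks of polarizations on the factors. -/
def HasProductPullback {n : ℕ} {E : Fin n → ComplexTorus ℂ} {A : ComplexTorus V}
    (f : Hom (pi E) A) (P : A.Polarization) : Prop :=
  ∃ h : ∀ i, (E i).Polarization,
    ∀ x y : Fin n → ℂ, P.form (f.lin x) (f.lin y) = ∑ i, (h i).form (x i) (y i)

/-- `f` embeds the `i`-th factor of the product onto the elliptic curve `C` in `A`. -/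
def EmbedsFactorOnto {n : ℕ} {E : Fin n → ComplexTorus ℂ} {A : ComplexTorus V}
    (f : Hom (pi E) A) (i : Fin n) (C : A.EllipticCurve) : Prop :=
  Function.Injective (f.comp (factor E i)).onPoints ∧
    LinearMap.range (f.comp (factor E i)).onPoints = C.carrier

end Product

/-! ### Complex multiplication, ordinary and extra-ordinary curves -/

/-- `E = ℂ / Λ` has complex multiplication: `End E ≠ ℤ`. -/
def HasCM (E : ComplexTorus ℂ) : Prop :=
  ∃ α : ℂ, (∀ z ∈ E.lattice, α * z ∈ E.lattice) ∧ ∀ n : ℤ, α ≠ n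

/-- The homomorphism `E → Eⁿ`, `x ↦ (v₁ x, …, vₙ x)`, for an integral vector `v`. -/
noncomputable def multHom (E : ComplexTorus ℂ) {n : ℕ} (v : Fin n → ℤ) : Hom E (pow E n) where
  lin := LinearMap.pi fun i => (v i : ℂ) • LinearMap.id
  map_lattice := by
    intro z hz i _
    have : (v i : ℂ) * z = v i • z := (zsmul_eq_mul z (v i)).symm
    change (v i : ℂ) * z ∈ E.lattice
    rw [this]
    exact E.lattice.smul_mem _ hz

/-- An elliptic curve in `Eⁿ` is ordinary if it is the image of `E` under `x ↦ (v₁ x, …, vₙ x)`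
for some primitive integral vector `v`. -/
def IsOrdinary {E : ComplexTorus ℂ} {n : ℕ} (D : (pow E n).EllipticCurve) : Prop :=
  ∃ v : Fin n → ℤ, (∀ d : ℤ, (∀ i, d ∣ v i) → IsUnit d) ∧
    D.carrier = LinearMap.range (E.multHom v).onPoints

section Images

variable {V : Type*} [NormedAddCommGroup V] [NormedSpace ℂ V]

/-- The elliptic curves in `A` that are images under `f : Eⁿ → A` of ordinary curves in `Eⁿ`. -/
def ordinaryCurves {E : ComplexTorus ℂ} {n : ℕ} {A : ComplexTorus V} (f : Hom (pow E n) A) :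
    Set A.EllipticCurve :=
  {C | ∃ D : (pow E n).EllipticCurve, IsOrdinary D ∧ C.carrier = D.carrier.map f.onPoints}

/-- The elliptic curves in `A` that are images under `f : Eⁿ → A` of extra-ordinary (that is,
not ordinary) elliptic curves in `Eⁿ`. -/
def extraordinaryCurves {E : ComplexTorus ℂ} {n : ℕ} {A : ComplexTorus V}
    (f : Hom (pow E n) A) : Set A.EllipticCurve :=
  {C | ∃ D : (pow E n).EllipticCurve, ¬ IsOrdinary D ∧ C.carrier = D.carrier.map f.onPoints}

end Images

end ComplexTorus

/-!
For an elliptic curve with tangent line `L`, the imaginary part `ω` of the polarization `H` is a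
non-zero integer on a basis `b₀, b₁` of `L ∩ Λ`, and the orthogonal projection to `L` is
`x ↦ (ω(x, b₁) b₀ - ω(x, b₀) b₁) / ω(b₀, b₁)`. Hence a multiple of it preserves `Λ`
(`Polarization.isRationalMap_proj`): it is a rational map, and rational maps send tangent spaces
of subtori to such spaces (`IsRational.map`). So orthogonal complements of sums of elliptic curves
are again tangent to subtori (`Polarization.exists_orthogonal_line`). A basis of `V` of vectors
tangent to elliptic curves gives an isogeny from the product of these curves
(`exists_isogeny_of_linearIndependent`), and the polarization pulls back to a product polarization
if the basis is orthogonal. These facts give the complementary curves.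

If a curve in a product has tangent vector `v` with `vᵢ ≠ 0`, then a multiple of `vⱼ / vᵢ` is a
homomorphism between the factors `i` and `j` (`IsRational.exists_mul_div_mem`). If no two factors
are isogenous, the only curves are therefore the factors (`exists_isogenous_of_lt_card`); this gives
the assertions about three and four curves. In a power `Eⁿ` the same fact shows that all `vⱼ / vᵢ`
are rational, i.e. that the curve is ordinary, unless `E` has complex multiplication
(`hasCM_of_not_isOrdinary`). Conversely the vectors `(1, k, 0, …)` and `(1, α + k, 0, …)`, for a
complex multiplication `α` and all integers `k`, are tangent to infinitely many ordinary and
extra-ordinary curves.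

For the counting function, lattice reduction in `L ∩ Λ` gives a non-zero lattice vector `x` with
`H(x, x) ≤ 2 d` on a curve of degree `d` (`EllipticCurve.exists_short_vector`), and `x` determines
the curve. The number of such lattice vectors is `O(d ^ g)`, which is even stronger than the
assertion.
-/

namespace ComplexTorus

/-! ### Lattices -/

section Lattices

variable {V : Type*} [NormedAddCommGroup V] [NormedSpace ℝ V] [FiniteDimensional ℝ V]

/-- A sublattice of full rank has finite index. The quotient is realized as the image in `V / Γ`. -/
theorem finite_map_mkQ_of_span_eq_top {Γ Λ : Submodule ℤ V} [DiscreteTopology Λ] (hle : Γ ≤ Λ)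
    (h : Submodule.span ℝ (Γ : Set V) = ⊤) : Finite (Λ.map Γ.mkQ) := by
  have : DiscreteTopology Γ := DiscreteTopology.of_subset (s := (Λ : Set V)) inferInstance hle
  have : IsZLattice ℝ Γ := ⟨h⟩
  have : IsZLattice ℝ Λ := ⟨eq_top_iff.2 (h ▸ Submodule.span_mono hle)⟩
  have hrank : Module.finrank ℤ (Γ.submoduleOf Λ) = Module.finrank ℤ Λ := by
    rw [(Submodule.submoduleOfEquivOfLe hle).finrank_eq, ZLattice.rank ℝ, ZLattice.rank ℝ]
  have := ZLattice.module_finite ℝ Λ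
  have := ZLattice.module_free ℝ Λ
  have hfin : Finite (Λ ⧸ Γ.submoduleOf Λ) := Submodule.finiteQuotientOfFreeOfRankEq _ hrank
  let φ : (Λ ⧸ Γ.submoduleOf Λ) →ₗ[ℤ] V ⧸ Γ := (Γ.submoduleOf Λ).mapQ Γ Λ.subtype le_rfl
  refine Set.Finite.subset (Set.finite_range φ) ?_
  rintro _ ⟨x, hx, rfl⟩
  exact ⟨Submodule.Quotient.mk ⟨x, hx⟩, rfl⟩

theorem exists_zsmul_mem_of_span_eq_top {Γ Λ : Submodule ℤ V} [DiscreteTopology Λ] (hle : Γ ≤ Λ)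
    (h : Submodule.span ℝ (Γ : Set V) = ⊤) :
    ∃ N : ℤ, N ≠ 0 ∧ ∀ x ∈ Λ, N • x ∈ Γ := by
  have := finite_map_mkQ_of_span_eq_top hle h
  refine ⟨Nat.card (Λ.map Γ.mkQ), by exact_mod_cast Nat.card_pos.ne', fun x hx => ?_⟩
  have h1 : Nat.card (Λ.map Γ.mkQ) • (⟨Γ.mkQ x, x, hx, rfl⟩ : Λ.map Γ.mkQ) = 0 :=
    card_nsmul_eq_zero'
  have h2 := congrArg Subtype.val h1
  rw [← Submodule.Quotient.mk_eq_zero]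
  simpa using h2

end Lattices

section Basic

variable {V W : Type*} [NormedAddCommGroup V] [NormedSpace ℂ V]
  [NormedAddCommGroup W] [NormedSpace ℂ W]

theorem countable_lattice [FiniteDimensional ℂ V] (A : ComplexTorus V) : Countable A.lattice := by
  have := A.discrete
  have : IsZLattice ℝ A.lattice := ⟨A.span_real⟩
  infer_instance

/-! ### Isogenies -/

/-- A vector all of whose real multiples lie, modulo a complex subspace, in countably many classes
belongs to the subspace. -/
theorem mem_of_forall_real_smul_sub_mem [FiniteDimensional ℂ V] (A : ComplexTorus V)
    (S : Submodule ℂ V) (v : V) (h : ∀ r : ℝ, ∃ l ∈ A.lattice, (r : ℂ) • v - l ∈ S) : v ∈ S := by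
  have := A.countable_lattice
  by_contra hv
  choose l hl hS using h
  have hinj : Function.Injective fun r : ℝ => (⟨l r, hl r⟩ : A.lattice) := by
    intro r s hrs
    by_contra hne
    have h1 := S.sub_mem (hS r) (hS s)
    rw [Subtype.mk.inj hrs, sub_sub_sub_cancel_right, ← sub_smul] at h1
    have h2 : ((r : ℂ) - s) ≠ 0 := by
      rw [sub_ne_zero]
      exact_mod_cast hne
    exact hv ((S.smul_mem_iff h2).1 h1)
  exact not_countable (α := ℝ) hinj.countable

theorem Hom.IsIsogeny.bijective [FiniteDimensional ℂ V] [FiniteDimensional ℂ W]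
    {A : ComplexTorus V} {B : ComplexTorus W} {f : Hom A B} (hf : f.IsIsogeny) :
    Function.Bijective f.lin := by
  obtain ⟨hsurj, hfin⟩ := hf
  constructor
  · rw [← LinearMap.ker_eq_bot, eq_bot_iff]
    intro x hx
    refine A.mem_of_forall_real_smul_sub_mem ⊥ x fun r => ?_
    -- the kernel of `f.lin` maps to the finite kernel on points, which has an exponent `N`
    set N := Nat.card (LinearMap.ker f.onPoints) with hN
    have hN0 : (N : ℂ) ≠ 0 := by exact_mod_cast Nat.card_pos.ne'
    refine ⟨(r : ℂ) • x, ?_, by simp⟩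
    have hy : f.lin (((r : ℂ) / N) • x) = 0 := by rw [map_smul, LinearMap.mem_ker.1 hx, smul_zero]
    have hk : A.lattice.mkQ (((r : ℂ) / N) • x) ∈ LinearMap.ker f.onPoints := by
      change B.lattice.mkQ (f.lin _) = 0
      rw [hy, map_zero]
    have h1 : N • (⟨_, hk⟩ : LinearMap.ker f.onPoints) = 0 := card_nsmul_eq_zero'
    have h2 := congrArg Subtype.val h1
    rw [← Submodule.Quotient.mk_eq_zero, ← Submodule.mkQ_apply]
    have h3 : (r : ℂ) • x = N • (((r : ℂ) / N) • x) := by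
      rw [← Nat.cast_smul_eq_nsmul ℂ, smul_smul, mul_div_cancel₀ _ hN0]
    rw [h3, map_nsmul]
    simpa using h2
  · rw [← LinearMap.range_eq_top, eq_top_iff]
    intro w _
    refine B.mem_of_forall_real_smul_sub_mem _ w fun r => ?_
    obtain ⟨x, hx⟩ := hsurj (B.lattice.mkQ ((r : ℂ) • w))
    obtain ⟨x, rfl⟩ := A.lattice.mkQ_surjective x
    have hx' : B.lattice.mkQ ((r : ℂ) • w) = B.lattice.mkQ (f.lin x) := hx.symm
    rw [Submodule.mkQ_apply, Submodule.mkQ_apply, Submodule.Quotient.eq] at hx'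
    exact ⟨_, hx', by simp⟩

theorem discrete_comap [FiniteDimensional ℂ V] (B : ComplexTorus W) (f : V →ₗ[ℂ] W)
    (hf : Function.Injective f) :
    DiscreteTopology (B.lattice.comap (f.restrictScalars ℤ)) := by
  have hB : DiscreteTopology (B.lattice : Set W) := B.discrete
  exact DiscreteTopology.preimage_of_continuous_injective (B.lattice : Set W)
    f.continuous_of_finiteDimensional hf

theorem Hom.isIsogeny_of_bijective [FiniteDimensional ℂ V]
    {A : ComplexTorus V} {B : ComplexTorus W} {f : Hom A B} (hf : Function.Bijective f.lin) :
    f.IsIsogeny := by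
  have : FiniteDimensional ℝ V := FiniteDimensional.complexToReal V
  constructor
  · intro y
    obtain ⟨y, rfl⟩ := B.lattice.mkQ_surjective y
    obtain ⟨x, rfl⟩ := hf.2 y
    exact ⟨A.lattice.mkQ x, rfl⟩
  · have := discrete_comap B f.lin hf.1
    have hfin := finite_map_mkQ_of_span_eq_top f.map_lattice A.span_real
    refine Set.Finite.subset hfin ?_
    intro x hx
    obtain ⟨x, rfl⟩ := A.lattice.mkQ_surjective x
    refine ⟨x, ?_, rfl⟩
    have hx' : B.lattice.mkQ (f.lin x) = 0 := hx
    have h0 := (Submodule.Quotient.mk_eq_zero _).1 hx'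
    exact h0

/-! ### Rational subspaces and rational maps -/

/-- A complex subspace `S` of `V` is rational with respect to the lattice of `A = V / Λ` if `S ∩ Λ`
spans `S` over `ℝ`, i.e. if it is the tangent space of a complex subtorus. -/
def IsRational (A : ComplexTorus V) (S : Submodule ℂ V) : Prop :=
  Submodule.span ℝ ((A.lattice : Set V) ∩ S) = S.restrictScalars ℝ

/-- A complex linear map is rational with respect to the lattices of two tori if a non-zero
integral multiple of it maps the first lattice into the second one. -/
def IsRationalMap (A : ComplexTorus V) (B : ComplexTorus W) (ρ : V →ₗ[ℂ] W) : Prop :=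
  ∃ N : ℤ, N ≠ 0 ∧ ∀ x ∈ A.lattice, N • ρ x ∈ B.lattice

theorem Hom.isRationalMap {A : ComplexTorus V} {B : ComplexTorus W} (f : Hom A B) :
    IsRationalMap A B f.lin :=
  ⟨1, one_ne_zero, fun x hx => by simpa using f.map_lattice hx⟩

theorem IsRationalMap.sub {A : ComplexTorus V} {B : ComplexTorus W} {ρ σ : V →ₗ[ℂ] W}
    (hρ : IsRationalMap A B ρ) (hσ : IsRationalMap A B σ) : IsRationalMap A B (ρ - σ) := by
  obtain ⟨M, hM, hρ⟩ := hρ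
  obtain ⟨N, hN, hσ⟩ := hσ
  refine ⟨M * N, mul_ne_zero hM hN, fun x hx => ?_⟩
  have h1 := B.lattice.smul_mem N (hρ x hx)
  have h2 := B.lattice.smul_mem M (hσ x hx)
  rw [smul_smul] at h1 h2
  rw [LinearMap.sub_apply, smul_sub]
  exact B.lattice.sub_mem (by rwa [mul_comm]) h2

theorem IsRationalMap.sum {A : ComplexTorus V} {B : ComplexTorus W} {ι : Type*} (s : Finset ι)
    {ρ : ι → V →ₗ[ℂ] W} (hρ : ∀ i, IsRationalMap A B (ρ i)) : IsRationalMap A B (∑ i ∈ s, ρ i) := by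
  classical
  choose N hN h using hρ
  refine ⟨∏ i ∈ s, N i, Finset.prod_ne_zero_iff.2 fun i _ => hN i, fun x hx => ?_⟩
  rw [LinearMap.sum_apply, Finset.smul_sum]
  refine B.lattice.sum_mem fun i hi => ?_
  rw [← Finset.prod_erase_mul _ _ hi, mul_smul]
  exact B.lattice.smul_mem _ (h i x hx)

theorem isRational_top (A : ComplexTorus V) : A.IsRational ⊤ := by
  simp [IsRational, A.span_real]

theorem IsRational.map {A : ComplexTorus V} {B : ComplexTorus W} {S : Submodule ℂ V}
    (hS : A.IsRational S) {ρ : V →ₗ[ℂ] W} (hρ : IsRationalMap A B ρ) : B.IsRational (S.map ρ) := by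
  obtain ⟨N, hN, h⟩ := hρ
  refine le_antisymm (Submodule.span_le.2 fun x hx => hx.2) ?_
  rintro _ ⟨x, hx, rfl⟩
  have hx' : x ∈ Submodule.span ℝ ((A.lattice : Set V) ∩ S) := by rw [hS]; exact hx
  clear hx
  induction hx' using Submodule.span_induction with
  | mem x hx =>
    have h1 : ρ x = (N : ℝ)⁻¹ • (N • ρ x) := by
      rw [← Int.cast_smul_eq_zsmul ℝ, smul_smul, inv_mul_cancel₀ (by exact_mod_cast hN), one_smul]
    rw [h1]
    refine Submodule.smul_mem _ _ (Submodule.subset_span ⟨h x hx.1, ?_⟩)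
    exact zsmul_mem (Submodule.mem_map_of_mem hx.2 : ρ x ∈ S.map ρ) N
  | zero => simp
  | add x y _ _ h1 h2 => rw [map_add]; exact Submodule.add_mem _ h1 h2
  | smul r x _ h1 => rw [LinearMap.map_smul_of_tower]; exact Submodule.smul_mem _ _ h1

theorem Hom.isRationalMap_symm [FiniteDimensional ℂ V] {A : ComplexTorus V} {B : ComplexTorus W}
    (f : Hom A B) (hf : Function.Bijective f.lin) :
    IsRationalMap B A (LinearEquiv.ofBijective f.lin hf).symm.toLinearMap := by
  have : FiniteDimensional ℝ V := FiniteDimensional.complexToReal V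
  have := discrete_comap B f.lin hf.1
  obtain ⟨N, hN, h⟩ := exists_zsmul_mem_of_span_eq_top f.map_lattice A.span_real
  refine ⟨N, hN, fun y hy => h _ ?_⟩
  change f.lin _ ∈ B.lattice
  have := (LinearEquiv.ofBijective f.lin hf).apply_symm_apply y
  rw [LinearEquiv.ofBijective_apply] at this
  rw [LinearEquiv.coe_coe, this]
  exact hy

/-! ### Isogenies between one-dimensional tori -/

theorem isogenous_iff {E F : ComplexTorus ℂ} :
    E.Isogenous F ↔ ∃ α : ℂ, α ≠ 0 ∧ ∀ z ∈ E.lattice, z * α ∈ F.lattice := by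
  constructor
  · rintro ⟨f, hf⟩
    have hmul : ∀ z, f.lin z = z * f.lin 1 := fun z => by
      have := f.lin.map_smul z 1
      rwa [smul_eq_mul, mul_one, smul_eq_mul] at this
    refine ⟨f.lin 1, ?_, fun z hz => ?_⟩
    · exact (map_ne_zero_iff _ hf.bijective.1).2 one_ne_zero
    · rw [← hmul]
      exact f.map_lattice hz
  · rintro ⟨α, hα, h⟩
    refine ⟨⟨LinearMap.toSpanSingleton ℂ ℂ α, fun z hz => h z hz⟩, Hom.isIsogeny_of_bijective ?_⟩
    exact ⟨fun x y hxy => mul_right_cancel₀ hα hxy, fun y => ⟨y / α, div_mul_cancel₀ _ hα⟩⟩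

theorem Isogenous.symm {E F : ComplexTorus ℂ} (h : E.Isogenous F) : F.Isogenous E := by
  obtain ⟨f, hf⟩ := h
  obtain ⟨N, hN, h⟩ := f.isRationalMap_symm hf.bijective
  set e := LinearEquiv.ofBijective f.lin hf.bijective
  refine isogenous_iff.2
    ⟨N * e.symm 1, mul_ne_zero (by exact_mod_cast hN) (by simp), fun z hz => ?_⟩
  have h1 : z * (N * e.symm 1) = N • e.symm z := by
    have := e.symm.map_smul z 1
    rw [smul_eq_mul, mul_one, smul_eq_mul] at this
    rw [this, zsmul_eq_mul]
    ring
  rw [h1]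
  exact h z hz

end Basic

section Vectors

variable {V W : Type*} [NormedAddCommGroup V] [NormedSpace ℂ V]
  [NormedAddCommGroup W] [NormedSpace ℂ W]

/-! ### Isogenies from products of elliptic curves -/

theorem EllipticCurve.exists_line_eq_span {A : ComplexTorus V} (C : A.EllipticCurve) :
    ∃ v : V, v ≠ 0 ∧ C.line = Submodule.span ℂ {v} ∧ A.IsRational (Submodule.span ℂ {v}) := by
  obtain ⟨v, hv, h⟩ := finrank_eq_one_iff'.1 C.finrank_line
  have hl : C.line = Submodule.span ℂ {(v : V)} := by
    refine le_antisymm (fun w hw => ?_) (by simp)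
    obtain ⟨c, hc⟩ := h ⟨w, hw⟩
    exact Submodule.mem_span_singleton.2 ⟨c, congrArg Subtype.val hc⟩
  exact ⟨v, by simpa using hv, hl, hl ▸ C.span_real⟩

theorem EllipticCurve.ext_line {A : ComplexTorus V} {C D : A.EllipticCurve}
    (h : C.line = D.line) : C = D := by
  cases C
  cases D
  cases h
  rfl

/-- The elliptic curve with tangent line `ℂ v`. -/
def curveOfVector (A : ComplexTorus V) (v : V) (hv : v ≠ 0)
    (hr : A.IsRational (Submodule.span ℂ {v})) : A.EllipticCurve where
  line := Submodule.span ℂ {v}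
  finrank_line := finrank_span_singleton hv
  span_real := hr

/-- The elliptic curve with tangent line `ℂ v`, as an abstract torus: the parameter `z` on the line
identifies it with `ℂ / {z | z v ∈ Λ}`. -/
noncomputable def lineTorus (A : ComplexTorus V) (v : V) (hv : v ≠ 0)
    (hr : A.IsRational (Submodule.span ℂ {v})) : ComplexTorus ℂ where
  lattice := A.lattice.comap ((LinearMap.toSpanSingleton ℂ V v).restrictScalars ℤ)
  discrete := discrete_comap A _ (smul_left_injective ℂ hv)
  span_real := by
    rw [eq_top_iff]
    intro z _
    set s : ℂ →ₗ[ℝ] V := (LinearMap.toSpanSingleton ℂ V v).restrictScalars ℝ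
    have hs : Function.Injective s := smul_left_injective ℂ hv
    set Γ := A.lattice.comap ((LinearMap.toSpanSingleton ℂ V v).restrictScalars ℤ)
    have h1 : s '' (Γ : Set ℂ) = (A.lattice : Set V) ∩ Submodule.span ℂ {v} := by
      ext x
      constructor
      · rintro ⟨z, hz, rfl⟩
        exact ⟨hz, Submodule.mem_span_singleton.2 ⟨z, rfl⟩⟩
      · rintro ⟨hx, hx'⟩
        obtain ⟨z, rfl⟩ := Submodule.mem_span_singleton.1 hx'
        exact ⟨z, hx, rfl⟩
    have h2 : s z ∈ (Submodule.span ℝ (Γ : Set ℂ)).map s := by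
      rw [Submodule.map_span, h1, hr]
      exact Submodule.mem_span_singleton.2 ⟨z, rfl⟩
    obtain ⟨z', hz', h⟩ := h2
    rwa [← hs h]

theorem mem_lattice_lineTorus {A : ComplexTorus V} {v : V} {hv : v ≠ 0}
    {hr : A.IsRational (Submodule.span ℂ {v})} {z : ℂ} :
    z ∈ (A.lineTorus v hv hr).lattice ↔ z • v ∈ A.lattice := Iff.rfl

/-- The homomorphism `∏ F i → A`, `x ↦ ∑ xᵢ wᵢ`. -/
noncomputable def Hom.ofVectors {A : ComplexTorus V} {n : ℕ} (F : Fin n → ComplexTorus ℂ)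
    (w : Fin n → V) (h : ∀ i, ∀ z ∈ (F i).lattice, z • w i ∈ A.lattice) : Hom (pi F) A where
  lin := Fintype.linearCombination ℂ w
  map_lattice := by
    intro x hx
    change ∑ i, x i • w i ∈ A.lattice
    exact A.lattice.sum_mem fun i _ => h i (x i) (hx i (Set.mem_univ i))

theorem Hom.ofVectors_isIsogeny [FiniteDimensional ℂ V] {A : ComplexTorus V} {n : ℕ}
    {F : Fin n → ComplexTorus ℂ} {w : Fin n → V}
    (h : ∀ i, ∀ z ∈ (F i).lattice, z • w i ∈ A.lattice) (hw : LinearIndependent ℂ w)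
    (hn : Module.finrank ℂ V = n) : (Hom.ofVectors F w h).IsIsogeny := by
  refine Hom.isIsogeny_of_bijective ?_
  have hinj : Function.Injective (Fintype.linearCombination ℂ w) :=
    hw.fintypeLinearCombination_injective
  exact ⟨hinj, (LinearMap.injective_iff_surjective_of_finrank_eq_finrank (by simp [hn])).1 hinj⟩

theorem Hom.ofVectors_factor {A : ComplexTorus V} {n : ℕ}
    {F : Fin n → ComplexTorus ℂ} {w : Fin n → V}
    (h : ∀ i, ∀ z ∈ (F i).lattice, z • w i ∈ A.lattice) (i : Fin n) (z : ℂ) :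
    (Hom.ofVectors F w h).lin (Pi.single i z) = z • w i := by
  classical
  exact Fintype.linearCombination_apply_single ℂ w i z

theorem Hom.ofVectors_embedsFactorOnto {A : ComplexTorus V} {n : ℕ}
    {F : Fin n → ComplexTorus ℂ} {w : Fin n → V}
    (h : ∀ i, ∀ z ∈ (F i).lattice, z • w i ∈ A.lattice) {i : Fin n}
    (hi : ∀ z, z • w i ∈ A.lattice → z ∈ (F i).lattice)
    {C : A.EllipticCurve} (hC : C.line = Submodule.span ℂ {w i}) :
    EmbedsFactorOnto (Hom.ofVectors F w h) i C := by
  have key : ∀ z : ℂ, ((Hom.ofVectors F w h).comp (factor F i)).onPoints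
      ((F i).lattice.mkQ z) = A.lattice.mkQ (z • w i) := fun z =>
    congrArg A.lattice.mkQ (Hom.ofVectors_factor h i z)
  constructor
  · rw [← LinearMap.ker_eq_bot, eq_bot_iff]
    intro x hx
    obtain ⟨z, rfl⟩ := (F i).lattice.mkQ_surjective x
    rw [LinearMap.mem_ker, key, Submodule.mkQ_apply, Submodule.Quotient.mk_eq_zero] at hx
    exact (Submodule.Quotient.mk_eq_zero _).2 (hi z hx)
  · ext y
    constructor
    · rintro ⟨x, rfl⟩
      obtain ⟨z, rfl⟩ := (F i).lattice.mkQ_surjective x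
      rw [key]
      refine Submodule.mem_map_of_mem ?_
      change z • w i ∈ C.line
      rw [hC]
      exact Submodule.mem_span_singleton.2 ⟨z, rfl⟩
    · rintro ⟨v, hv, rfl⟩
      change v ∈ C.line at hv
      rw [hC] at hv
      obtain ⟨z, rfl⟩ := Submodule.mem_span_singleton.1 hv
      exact ⟨(F i).lattice.mkQ z, key z⟩

/-! ### Polarizations and product polarizations -/

theorem Polarization.form_smul_smul {A : ComplexTorus V} (P : A.Polarization) (a b : ℂ) (x y : V) :
    P.form (a • x) (b • y) = a * (starRingEnd ℂ) b * P.form x y := by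
  rw [LinearMap.map_smulₛₗ, map_smul P.form, LinearMap.smul_apply, smul_eq_mul, smul_eq_mul]
  ring

theorem Polarization.form_self_im {A : ComplexTorus V} (P : A.Polarization) (x : V) :
    (P.form x x).im = 0 := by
  have := congrArg Complex.im (P.hermitian x x)
  rw [Complex.conj_im] at this
  linarith

theorem Polarization.form_self_ne_zero {A : ComplexTorus V} (P : A.Polarization) {x : V}
    (hx : x ≠ 0) : P.form x x ≠ 0 := by
  intro h
  have := P.pos x hx
  simp [h] at this

theorem Polarization.form_eq_zero_symm {A : ComplexTorus V} (P : A.Polarization) {x y : V}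
    (h : P.form x y = 0) : P.form y x = 0 := by
  rw [P.hermitian, h, map_zero]

/-- The pullback of a polarization by a homomorphism that is injective on tangent spaces. -/
noncomputable def Polarization.pullback {A : ComplexTorus V} {B : ComplexTorus W}
    (P : B.Polarization) (f : Hom A B) (hf : Function.Injective f.lin) : A.Polarization where
  form := (P.form ∘ₗ f.lin).compl₂ f.lin
  hermitian := fun x y => P.hermitian (f.lin x) (f.lin y)
  pos := fun _ hx => P.pos _ ((map_ne_zero_iff _ hf).2 hx)
  integral := fun _ hx _ hy => P.integral _ (f.map_lattice hx) _ (f.map_lattice hy)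

theorem Hom.ofVectors_hasProductPullback {A : ComplexTorus V} (P : A.Polarization) {n : ℕ}
    {F : Fin n → ComplexTorus ℂ} {w : Fin n → V}
    (h : ∀ i, ∀ z ∈ (F i).lattice, z • w i ∈ A.lattice) (hw : ∀ i, w i ≠ 0)
    (horth : ∀ i j, i ≠ j → P.form (w i) (w j) = 0) :
    HasProductPullback (Hom.ofVectors F w h) P := by
  have hinj : ∀ i, Function.Injective ((Hom.ofVectors F w h).comp (factor F i)).lin := by
    intro i x y hxy
    have hxy' : (Hom.ofVectors F w h).lin (Pi.single i x)
      = (Hom.ofVectors F w h).lin (Pi.single i y) := hxy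
    rw [Hom.ofVectors_factor, Hom.ofVectors_factor] at hxy'
    exact smul_left_injective ℂ (hw i) hxy'
  refine ⟨fun i => P.pullback _ (hinj i), fun x y => ?_⟩
  have hform : ∀ i, (P.pullback _ (hinj i)).form (x i) (y i)
      = P.form (x i • w i) (y i • w i) := by
    intro i
    change P.form ((Hom.ofVectors F w h).lin (Pi.single i (x i)))
      ((Hom.ofVectors F w h).lin (Pi.single i (y i))) = _
    rw [Hom.ofVectors_factor, Hom.ofVectors_factor]
  have hlin : ∀ x, (Hom.ofVectors F w h).lin x = ∑ i, x i • w i := fun x => rfl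
  rw [hlin, hlin, map_sum]
  refine Finset.sum_congr rfl fun j _ => ?_
  rw [hform, map_sum, LinearMap.sum_apply, Finset.sum_eq_single j]
  · intro i _ hi
    rw [P.form_smul_smul, horth i j hi, mul_zero]
  · simp

/-! ### Orthogonal complements -/

theorem Polarization.linearIndependent {A : ComplexTorus V} (P : A.Polarization) {ι : Type*}
    {w : ι → V} (hw : ∀ i, w i ≠ 0) (horth : ∀ i j, i ≠ j → P.form (w i) (w j) = 0) :
    LinearIndependent ℂ w :=
  LinearMap.linearIndependent_of_isOrthoᵢ (B := P.form) (fun i j hij => horth i j hij)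
    fun i => P.form_self_ne_zero (hw i)

/-- The orthogonal projection to the line `ℂ v`. -/
noncomputable def Polarization.proj {A : ComplexTorus V} (P : A.Polarization) (v : V) :
    V →ₗ[ℂ] V :=
  ((P.form v v)⁻¹ • P.form.flip v).smulRight v

theorem Polarization.proj_apply {A : ComplexTorus V} (P : A.Polarization) (v x : V) :
    P.proj v x = ((P.form v v)⁻¹ * P.form x v) • v := rfl

/-- The alternating form is non-zero on a basis of the lattice of an elliptic curve, because
otherwise the lattice would lie on a real line. -/
theorem EllipticCurve.form_basis_im_ne_zero {A : ComplexTorus V} (C : A.EllipticCurve)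
    (P : A.Polarization) (b : Module.Basis (Fin 2) ℤ C.lattice) :
    (P.form (b 0 : V) (b 1 : V)).im ≠ 0 := by
  intro h
  obtain ⟨v, hv, hl, -⟩ := C.exists_line_eq_span
  have hb0 : (b 0 : V) ≠ 0 := fun h0 => b.ne_zero 0 (Subtype.ext h0)
  have hmem : ∀ i, ∃ c : ℂ, c • v = b i := fun i => by
    have : (b i : V) ∈ C.line := (b i).2.2
    rw [hl] at this
    exact Submodule.mem_span_singleton.1 this
  obtain ⟨c₀, hc₀⟩ := hmem 0
  obtain ⟨c₁, hc₁⟩ := hmem 1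
  have hc₀0 : c₀ ≠ 0 := by
    rintro rfl
    exact hb0 (by rw [← hc₀, zero_smul])
  have hc : (b 1 : V) = (c₁ / c₀) • (b 0 : V) := by
    rw [← hc₀, ← hc₁, smul_smul, div_mul_cancel₀ _ hc₀0]
  have him : (c₁ / c₀).im = 0 := by
    rw [hc, LinearMap.map_smulₛₗ, smul_eq_mul, Complex.mul_im, P.form_self_im, mul_zero, zero_add,
      Complex.conj_im] at h
    rcases mul_eq_zero.1 h with h | h
    · linarith
    · exact absurd h (P.pos _ hb0).ne'
  have hreal : ((c₁ / c₀).re : ℂ) = c₁ / c₀ := Complex.ext rfl (by simp [him])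
  have hsub : Submodule.span ℝ ((A.lattice : Set V) ∩ C.line) ≤ Submodule.span ℝ {(b 0 : V)} := by
    refine Submodule.span_le.2 fun x hx => ?_
    have h1 := congrArg Subtype.val (b.sum_repr ⟨x, hx⟩)
    rw [Fin.sum_univ_two] at h1
    refine Submodule.mem_span_singleton.2
      ⟨b.repr ⟨x, hx⟩ 0 + b.repr ⟨x, hx⟩ 1 * (c₁ / c₀).re, ?_⟩
    refine Eq.trans ?_ h1
    simp only [Submodule.coe_add, Submodule.coe_smul]
    rw [hc, ← hreal, Complex.ofReal_re, Complex.coe_smul, ← Int.cast_smul_eq_zsmul ℝ,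
      ← Int.cast_smul_eq_zsmul ℝ, smul_smul, add_smul]
  have hI : Complex.I • (b 0 : V) ∈ Submodule.span ℝ ((A.lattice : Set V) ∩ C.line) := by
    rw [C.span_real]
    exact C.line.smul_mem _ (b 0).2.2
  obtain ⟨r, hr⟩ := Submodule.mem_span_singleton.1 (hsub hI)
  rw [← Complex.coe_smul] at hr
  have := congrArg Complex.im (smul_left_injective ℂ hb0 hr)
  simp at this

/-- If `b₀, b₁` is a basis of the lattice of an elliptic curve and `ω` the imaginary part of the
polarization, the orthogonal projection of `x` to the curve is
`(ω(x, b₁) b₀ - ω(x, b₀) b₁) / ω(b₀, b₁)`. -/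
theorem Polarization.isRationalMap_proj [FiniteDimensional ℂ V] {A : ComplexTorus V}
    (P : A.Polarization) {v : V} (hv : v ≠ 0) (hr : A.IsRational (Submodule.span ℂ {v})) :
    IsRationalMap A A (P.proj v) := by
  set C := A.curveOfVector v hv hr
  obtain ⟨b⟩ := C.exists_basis
  have hω := C.form_basis_im_ne_zero P b
  obtain ⟨c₀, hc₀⟩ := Submodule.mem_span_singleton.1 (b 0).2.2
  obtain ⟨c₁, hc₁⟩ := Submodule.mem_span_singleton.1 (b 1).2.2
  have hA : ∀ i, (b i : V) ∈ A.lattice := fun i => (b i).2.1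
  obtain ⟨d, hd⟩ := P.integral _ (hA 0) _ (hA 1)
  refine ⟨d, fun h0 => hω (by simp [hd, h0]), fun x hx => ?_⟩
  obtain ⟨n₀, hn₀⟩ := P.integral x hx _ (hA 0)
  obtain ⟨n₁, hn₁⟩ := P.integral x hx _ (hA 1)
  have hmain : d • P.proj v x = n₁ • (b 0 : V) - n₀ • (b 1 : V) := by
    have hs : P.form v v = ((P.form v v).re : ℂ) := Complex.ext rfl (by simp [P.form_self_im])
    have hs0 := P.form_self_ne_zero hv
    rw [← hc₀, ← hc₁, P.form_smul_smul] at hd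
    rw [← hc₀, LinearMap.map_smulₛₗ] at hn₀
    rw [← hc₁, LinearMap.map_smulₛₗ] at hn₁
    rw [P.proj_apply, ← hc₀, ← hc₁]
    simp only [← Int.cast_smul_eq_zsmul ℂ, smul_smul, ← sub_smul]
    congr 1
    have hd' : (d : ℂ) = ((c₀ * (starRingEnd ℂ) c₁).im : ℂ) * P.form v v := by
      rw [hs] at hd ⊢
      have : (d : ℝ) = (c₀ * (starRingEnd ℂ) c₁).im * (P.form v v).re := by
        rw [← hd]
        simp
      exact_mod_cast congrArg (fun r : ℝ => (r : ℂ)) this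
    have hn₀' : (n₀ : ℂ) = (((starRingEnd ℂ) c₀ * P.form x v).im : ℂ) := by
      exact_mod_cast congrArg (fun r : ℝ => (r : ℂ)) hn₀.symm
    have hn₁' : (n₁ : ℂ) = (((starRingEnd ℂ) c₁ * P.form x v).im : ℂ) := by
      exact_mod_cast congrArg (fun r : ℝ => (r : ℂ)) hn₁.symm
    rw [hd', hn₀', hn₁', mul_assoc, mul_inv_cancel_left₀ hs0]
    generalize P.form x v = h
    apply Complex.ext <;> simp <;> ring
  rw [hmain]
  exact A.lattice.sub_mem (A.lattice.smul_mem _ (hA 0)) (A.lattice.smul_mem _ (hA 1))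

/-- Positive definiteness: a vector orthogonal to a basis is zero. -/
theorem Polarization.eq_zero_of_orthogonal [FiniteDimensional ℂ V] {A : ComplexTorus V}
    (P : A.Polarization) {ι : Type*} [Fintype ι] {w : ι → V} (hw : LinearIndependent ℂ w)
    (hn : Module.finrank ℂ V = Fintype.card ι) {z : V} (hz : ∀ i, P.form z (w i) = 0) : z = 0 := by
  by_contra h
  refine P.form_self_ne_zero h ?_
  have hmem : z ∈ Submodule.span ℂ (Set.range w) := by
    rw [hw.span_eq_top_of_card_eq_finrank' hn.symm]
    trivial
  have hker : Submodule.span ℂ (Set.range w) ≤ LinearMap.ker (P.form z) := by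
    rw [Submodule.span_le]
    rintro _ ⟨i, rfl⟩
    exact hz i
  exact hker hmem

/-- Poincaré reducibility for lines: an orthogonal family of rational lines with a sum of
codimension one is completed by a rational line, the image of a rational projection. -/
theorem Polarization.exists_orthogonal_line [FiniteDimensional ℂ V] {A : ComplexTorus V}
    (P : A.Polarization) {n : ℕ} {w : Fin n → V} (hw : ∀ i, w i ≠ 0)
    (hr : ∀ i, A.IsRational (Submodule.span ℂ {w i}))
    (horth : ∀ i j, i ≠ j → P.form (w i) (w j) = 0) (hn : Module.finrank ℂ V = n + 1) :
    ∃ u : V, u ≠ 0 ∧ A.IsRational (Submodule.span ℂ {u}) ∧ ∀ i, P.form u (w i) = 0 := by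
  set ρ : V →ₗ[ℂ] V := LinearMap.id - ∑ i, P.proj (w i) with hρ
  have hρapp : ∀ x, ρ x = x - ∑ i, P.proj (w i) x := fun x => by simp [hρ]
  have hrat : IsRationalMap A A ρ :=
    IsRationalMap.sub ⟨1, one_ne_zero, fun x hx => by simpa using hx⟩
      (IsRationalMap.sum _ fun i => P.isRationalMap_proj (hw i) (hr i))
  have hperp : ∀ x j, P.form (ρ x) (w j) = 0 := by
    intro x j
    rw [hρapp, map_sub, LinearMap.sub_apply, map_sum, LinearMap.sum_apply,
      Finset.sum_eq_single j, P.proj_apply, map_smul, LinearMap.smul_apply, smul_eq_mul]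
    · have := P.form_self_ne_zero (hw j)
      field_simp
      ring
    · intro i _ hi
      rw [P.proj_apply, map_smul, LinearMap.smul_apply, horth i j hi, smul_zero]
    · simp
  obtain ⟨x, hx⟩ : ∃ x, ρ x ≠ 0 := by
    by_contra! h
    have htop : Submodule.span ℂ (Set.range w) = ⊤ := by
      rw [eq_top_iff]
      intro x _
      have := h x
      rw [hρapp, sub_eq_zero] at this
      rw [this]
      exact Submodule.sum_mem _ fun i _ =>
        Submodule.smul_mem _ _ (Submodule.subset_span ⟨i, rfl⟩)
    have h1 := finrank_range_le_card (R := ℂ) w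
    rw [Set.finrank, htop, finrank_top, hn, Fintype.card_fin] at h1
    omega
  have hindep : LinearIndependent ℂ (fun o : Option (Fin n) => o.elim (ρ x) w) := by
    refine P.linearIndependent ?_ ?_
    · rintro (_ | i)
      exacts [hx, hw i]
    · rintro (_ | i) (_ | j) hij
      exacts [absurd rfl hij, hperp x j, P.form_eq_zero_symm (hperp x i),
        horth i j fun h => hij (h ▸ rfl)]
  have hrange : Submodule.map ρ ⊤ = Submodule.span ℂ {ρ x} := by
    refine le_antisymm ?_ ?_
    · rintro _ ⟨y, -, rfl⟩
      have h0 : ρ y - P.proj (ρ x) (ρ y) = 0 := by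
        refine P.eq_zero_of_orthogonal hindep (by simp [hn]) ?_
        rintro (_ | i)
        · have := P.form_self_ne_zero hx
          simp only [Option.elim]
          rw [map_sub, LinearMap.sub_apply, P.proj_apply, map_smul, LinearMap.smul_apply,
            smul_eq_mul]
          field_simp
          ring
        · simp only [Option.elim]
          rw [map_sub, LinearMap.sub_apply, P.proj_apply, map_smul, LinearMap.smul_apply,
            hperp, hperp, smul_zero, sub_zero]
      rw [sub_eq_zero] at h0
      rw [h0]
      exact Submodule.mem_span_singleton.2 ⟨_, rfl⟩
    · rw [Submodule.span_singleton_le_iff_mem]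
      exact ⟨x, trivial, rfl⟩
  exact ⟨ρ x, hx, hrange ▸ A.isRational_top.map hrat, hperp x⟩

end Vectors

section Frames

variable {V W : Type*} [NormedAddCommGroup V] [NormedSpace ℂ V]
  [NormedAddCommGroup W] [NormedSpace ℂ W]

/-! ### Elliptic curves in a product and isogenies between the factors -/

theorem Isogenous.refl (E : ComplexTorus ℂ) : E.Isogenous E :=
  isogenous_iff.2 ⟨1, one_ne_zero, fun z hz => by rwa [mul_one]⟩

theorem Isogenous.trans {E F G : ComplexTorus ℂ} (h : E.Isogenous F) (h' : F.Isogenous G) :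
    E.Isogenous G := by
  obtain ⟨α, hα, h⟩ := isogenous_iff.1 h
  obtain ⟨β, hβ, h'⟩ := isogenous_iff.1 h'
  exact isogenous_iff.2 ⟨α * β, mul_ne_zero hα hβ, fun z hz => by
    rw [← mul_assoc]; exact h' _ (h z hz)⟩

/-- The quotients of the coordinates of an elliptic curve in a product are, up to an integral
factor, homomorphisms between the factors: the curve projects onto the `i`-th factor by an isogeny,
whose quasi-inverse can be composed with the `j`-th projection. -/
theorem IsRational.exists_mul_div_mem {n : ℕ} {E : Fin n → ComplexTorus ℂ} {v : Fin n → ℂ}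
    (hr : (pi E).IsRational (Submodule.span ℂ {v})) {i : Fin n} (hi : v i ≠ 0) :
    ∃ N : ℤ, N ≠ 0 ∧ ∀ j, ∀ z ∈ (E i).lattice, z * (N * (v j / v i)) ∈ (E j).lattice := by
  have hv : v ≠ 0 := fun h => hi (by rw [h, Pi.zero_apply])
  let f : Hom ((pi E).lineTorus v hv hr) (E i) :=
    ⟨LinearMap.toSpanSingleton ℂ ℂ (v i), fun z hz => hz i (Set.mem_univ i)⟩
  have hf : Function.Bijective f.lin :=
    ⟨fun x y hxy => mul_right_cancel₀ hi hxy, fun y => ⟨y / v i, div_mul_cancel₀ _ hi⟩⟩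
  obtain ⟨N, hN, h⟩ := f.isRationalMap_symm hf
  refine ⟨N, hN, fun j z hz => ?_⟩
  have h1 : (LinearEquiv.ofBijective f.lin hf).symm z = z / v i := by
    rw [LinearEquiv.symm_apply_eq, LinearEquiv.ofBijective_apply]
    exact (div_mul_cancel₀ _ hi).symm
  have h2 := h z hz
  rw [LinearEquiv.coe_coe, h1, mem_lattice_lineTorus] at h2
  have h3 := h2 j (Set.mem_univ j)
  have h4 : z * (N * (v j / v i)) = ((N • (z / v i)) • v) j := by
    rw [Pi.smul_apply, smul_eq_mul, zsmul_eq_mul]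
    ring
  rw [h4]
  exact h3

/-- If the factors are pairwise non-isogenous, the tangent line of an elliptic curve in the product
is a coordinate axis, so there are at most `n` curves. -/
theorem exists_isogenous_of_lt_card [FiniteDimensional ℂ V] {A : ComplexTorus V} {n : ℕ}
    {E : Fin n → ComplexTorus ℂ} {f : Hom (pi E) A} (hf : f.IsIsogeny)
    (hcard : (n : ℕ∞) < ENat.card A.EllipticCurve) :
    ∃ i j, i ≠ j ∧ (E i).Isogenous (E j) := by
  by_contra! hE
  have key : ∀ C : A.EllipticCurve, ∃ i : Fin n,
      C.line = Submodule.span ℂ {f.lin (Pi.single i 1)} := by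
    intro C
    obtain ⟨v, hv, hl, hr⟩ := C.exists_line_eq_span
    set e := LinearEquiv.ofBijective f.lin hf.bijective with he
    set u := e.symm v
    have hr' : (pi E).IsRational (Submodule.span ℂ {u}) := by
      have := hr.map (f.isRationalMap_symm hf.bijective)
      rwa [Submodule.map_span, Set.image_singleton] at this
    have hu : u ≠ 0 := e.symm.map_ne_zero_iff.2 hv
    obtain ⟨i, hi⟩ := Function.ne_iff.1 hu
    obtain ⟨N, hN, hmul⟩ := hr'.exists_mul_div_mem hi
    have hzero : ∀ j, j ≠ i → u j = 0 := by
      intro j hj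
      by_contra huj
      exact hE i j hj.symm (isogenous_iff.2
        ⟨N * (u j / u i), mul_ne_zero (by exact_mod_cast hN) (div_ne_zero huj hi), hmul j⟩)
    have hui : u = u i • Pi.single i 1 := by
      ext j
      by_cases hj : j = i
      · subst hj
        simp
      · simp [hzero j hj, hj]
    have hvu : v = u i • f.lin (Pi.single i 1) := by
      rw [← map_smul, ← hui]
      exact (e.apply_symm_apply v).symm
    refine ⟨i, ?_⟩
    rw [hl, hvu]
    exact Submodule.span_singleton_smul_eq (IsUnit.mk0 _ hi) _
  choose φ hφ using key
  have hinj : Function.Injective φ := fun C D h => EllipticCurve.ext_line (by rw [hφ C, hφ D, h])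
  have := ENat.card_le_card_of_injective hinj
  rw [ENat.card_eq_coe_fintype_card (α := Fin n), Fintype.card_fin] at this
  exact absurd hcard (not_lt.2 this)

/-! ### Orthogonal decompositions -/

/-- An orthogonal basis of `V` consisting of tangent vectors to elliptic curves. -/
structure OrthogonalFrame (A : ComplexTorus V) (P : A.Polarization) {n : ℕ} (w : Fin n → V) :
    Prop where
  ne_zero : ∀ i, w i ≠ 0
  isRational : ∀ i, A.IsRational (Submodule.span ℂ {w i})
  orthogonal : ∀ i j, i ≠ j → P.form (w i) (w j) = 0
  finrank : Module.finrank ℂ V = n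

theorem OrthogonalFrame.exists_isogeny [FiniteDimensional ℂ V] {A : ComplexTorus V}
    {P : A.Polarization} {n : ℕ} {w : Fin n → V} (h : OrthogonalFrame A P w)
    (σ : Equiv.Perm (Fin n)) {F : Fin n → ComplexTorus ℂ}
    (hF : ∀ i, (F i).Isogenous (A.lineTorus (w (σ i)) (h.ne_zero _) (h.isRational _))) :
    ∃ f : Hom (pi F) A, f.IsIsogeny ∧ HasProductPullback f P := by
  choose a ha0 ha using fun i => isogenous_iff.1 (hF i)
  have hmem : ∀ i, ∀ z ∈ (F i).lattice, z • (a i • w (σ i)) ∈ A.lattice := by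
    intro i z hz
    rw [smul_smul]
    exact ha i z hz
  have hne : ∀ i, a i • w (σ i) ≠ 0 := fun i => smul_ne_zero (ha0 i) (h.ne_zero _)
  have horth : ∀ i j, i ≠ j → P.form (a i • w (σ i)) (a j • w (σ j)) = 0 := by
    intro i j hij
    rw [P.form_smul_smul, h.orthogonal _ _ (σ.injective.ne hij), mul_zero]
  exact ⟨Hom.ofVectors F _ hmem,
    Hom.ofVectors_isIsogeny hmem (P.linearIndependent hne horth) h.finrank,
    Hom.ofVectors_hasProductPullback P hmem hne horth⟩

/-- A basis of `V` consisting of tangent vectors to elliptic curves gives an isogeny to `A` from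
the product of these curves. -/
theorem exists_isogeny_of_linearIndependent [FiniteDimensional ℂ V] (A : ComplexTorus V)
    {n : ℕ} {w : Fin n → V} (hw : LinearIndependent ℂ w)
    (hr : ∀ i, A.IsRational (Submodule.span ℂ {w i})) (hn : Module.finrank ℂ V = n) :
    ∃ (E : Fin n → ComplexTorus ℂ) (f : Hom (pi E) A), f.IsIsogeny ∧
      (∀ i (C : A.EllipticCurve), C.line = Submodule.span ℂ {w i} → EmbedsFactorOnto f i C) ∧
      ∀ P : A.Polarization, (∀ i j, i ≠ j → P.form (w i) (w j) = 0) → HasProductPullback f P := by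
  have hmem : ∀ i, ∀ z ∈ (A.lineTorus (w i) (hw.ne_zero i) (hr i)).lattice, z • w i ∈ A.lattice :=
    fun _ _ hz => hz
  exact ⟨fun i => A.lineTorus (w i) (hw.ne_zero i) (hr i), Hom.ofVectors _ w hmem,
    Hom.ofVectors_isIsogeny hmem hw hn,
    fun i C hC => Hom.ofVectors_embedsFactorOnto hmem (fun _ hz => hz) hC,
    fun P horth => Hom.ofVectors_hasProductPullback P hmem hw.ne_zero horth⟩

theorem OrthogonalFrame.linearIndependent {A : ComplexTorus V} {P : A.Polarization} {n : ℕ}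
    {w : Fin n → V} (h : OrthogonalFrame A P w) : LinearIndependent ℂ w :=
  P.linearIndependent h.ne_zero h.orthogonal

theorem Polarization.exists_orthogonalFrame_two [FiniteDimensional ℂ V] {A : ComplexTorus V}
    (P : A.Polarization) (hn : Module.finrank ℂ V = 2) {v : V} (hv : v ≠ 0)
    (hr : A.IsRational (Submodule.span ℂ {v})) : ∃ u, OrthogonalFrame A P ![v, u] := by
  obtain ⟨u, hu, hur, horth⟩ := P.exists_orthogonal_line (w := ![v]) (by simpa using hv)
    (by simpa using hr) (fun i j hij => absurd (Subsingleton.elim i j) hij) hn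
  have huv : P.form u v = 0 := horth 0
  refine ⟨u, ⟨?_, ?_, ?_, hn⟩⟩
  · simp [Fin.forall_fin_two, hv, hu]
  · simp [Fin.forall_fin_two, hr, hur]
  · simp [Fin.forall_fin_two, huv, P.form_eq_zero_symm huv]

/-- In dimension three, two different elliptic curves lie in an orthogonal frame: the first is
spanned by the first vector, the second lies in the plane of the first two vectors. -/
theorem Polarization.exists_orthogonalFrame_three [FiniteDimensional ℂ V] {A : ComplexTorus V}
    (P : A.Polarization) (hn : Module.finrank ℂ V = 3) {v v' : V} (hv : v ≠ 0)
    (hv' : v' ∉ Submodule.span ℂ {v}) (hr : A.IsRational (Submodule.span ℂ {v}))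
    (hr' : A.IsRational (Submodule.span ℂ {v'})) :
    ∃ u₁ u₂, OrthogonalFrame A P ![v, u₁, u₂] ∧ P.form v' u₂ = 0 := by
  set u₁ := v' - P.proj v v' with hu₁
  have hvv := P.form_self_ne_zero hv
  have hu₁0 : u₁ ≠ 0 := by
    intro h
    rw [hu₁, sub_eq_zero] at h
    exact hv' (h ▸ Submodule.mem_span_singleton.2 ⟨_, rfl⟩)
  have hu₁r : A.IsRational (Submodule.span ℂ {u₁}) := by
    have hid : IsRationalMap A A LinearMap.id := ⟨1, one_ne_zero, fun x hx => by simpa using hx⟩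
    have := hr'.map (hid.sub (P.isRationalMap_proj hv hr))
    rwa [Submodule.map_span, Set.image_singleton] at this
  have hu₁v : P.form u₁ v = 0 := by
    rw [hu₁, map_sub, LinearMap.sub_apply, P.proj_apply, map_smul, LinearMap.smul_apply,
      smul_eq_mul]
    field_simp
    ring
  have hvu₁ := P.form_eq_zero_symm hu₁v
  obtain ⟨u₂, hu₂, hu₂r, horth⟩ := P.exists_orthogonal_line (w := ![v, u₁])
    (by simp [Fin.forall_fin_two, hv, hu₁0]) (by simp [Fin.forall_fin_two, hr, hu₁r])
    (by simp [Fin.forall_fin_two, hu₁v, hvu₁]) hn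
  have h20 : P.form u₂ v = 0 := horth 0
  have h21 : P.form u₂ u₁ = 0 := horth 1
  have h02 := P.form_eq_zero_symm h20
  have h12 := P.form_eq_zero_symm h21
  refine ⟨u₁, u₂, ⟨?_, ?_, ?_, hn⟩, ?_⟩
  · simp [Fin.forall_fin_succ, hv, hu₁0, hu₂]
  · simp [Fin.forall_fin_succ, hr, hu₁r, hu₂r]
  · intro i j hij
    fin_cases i <;> fin_cases j <;> first | exact absurd rfl hij | assumption
  · have : v' = u₁ + P.proj v v' := by rw [hu₁, sub_add_cancel]
    rw [this, map_add, LinearMap.add_apply, h12, P.proj_apply, map_smul, LinearMap.smul_apply, h02,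
      smul_zero, add_zero]

theorem EllipticCurve.notMem_span_of_ne {A : ComplexTorus V} {C C' : A.EllipticCurve}
    (h : C ≠ C') {v v' : V} (hv' : v' ≠ 0) (hC : C.line = Submodule.span ℂ {v})
    (hC' : C'.line = Submodule.span ℂ {v'}) : v' ∉ Submodule.span ℂ {v} := by
  intro hmem
  obtain ⟨c, rfl⟩ := Submodule.mem_span_singleton.1 hmem
  refine h (EllipticCurve.ext_line ?_)
  rw [hC, hC', Submodule.span_singleton_smul_eq (IsUnit.mk0 _ (left_ne_zero_of_smul hv'))]

end Frames

section Powers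

variable {V W : Type*} [NormedAddCommGroup V] [NormedSpace ℂ V]
  [NormedAddCommGroup W] [NormedSpace ℂ W]

/-! ### Ordinary and extra-ordinary curves -/

/-- The image of an elliptic curve under a homomorphism that is injective on tangent spaces. -/
def EllipticCurve.map {A : ComplexTorus V} {B : ComplexTorus W} (C : A.EllipticCurve)
    (g : Hom A B) (hg : Function.Injective g.lin) : B.EllipticCurve where
  line := C.line.map g.lin
  finrank_line := by
    rw [← (Submodule.equivMapOfInjective g.lin hg C.line).finrank_eq, C.finrank_line]
  span_real := IsRational.map C.span_real g.isRationalMap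

theorem EllipticCurve.carrier_map {A : ComplexTorus V} {B : ComplexTorus W} (C : A.EllipticCurve)
    (g : Hom A B) (hg : Function.Injective g.lin) :
    (C.map g hg).carrier = C.carrier.map g.onPoints := by
  ext y
  constructor
  · rintro ⟨_, ⟨x, hx, rfl⟩, rfl⟩
    exact ⟨A.lattice.mkQ x, ⟨x, hx, rfl⟩, rfl⟩
  · rintro ⟨_, ⟨x, hx, rfl⟩, rfl⟩
    exact ⟨g.lin x, ⟨x, hx, rfl⟩, rfl⟩

theorem EllipticCurve.map_injective {A : ComplexTorus V} {B : ComplexTorus W}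
    (g : Hom A B) (hg : Function.Injective g.lin) :
    Function.Injective fun C : A.EllipticCurve => C.map g hg := fun _ _ h =>
  EllipticCurve.ext_line (Submodule.map_injective_of_injective hg (congrArg EllipticCurve.line h))

variable {E : ComplexTorus ℂ} {n : ℕ}

theorem isRational_span_of_forall_mul_mem {a : Fin n → ℂ}
    (ha : ∀ i, ∀ z ∈ E.lattice, z * a i ∈ E.lattice) :
    (pow E n).IsRational (Submodule.span ℂ {a}) := by
  let f : Hom E (pow E n) :=
    ⟨LinearMap.toSpanSingleton ℂ _ a, fun z hz i _ => ha i z hz⟩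
  have := E.isRational_top.map f.isRationalMap
  rwa [Submodule.map_top, LinearMap.range_toSpanSingleton] at this

theorem mul_intCast_mem {z : ℂ} (hz : z ∈ E.lattice) (k : ℤ) : z * k ∈ E.lattice := by
  rw [mul_comm, ← zsmul_eq_mul]
  exact E.lattice.smul_mem k hz

theorem intCast_ne_zero {v : Fin n → ℤ} (hv : v ≠ 0) : (fun i => (v i : ℂ)) ≠ 0 := by
  obtain ⟨i, hi⟩ := Function.ne_iff.1 hv
  exact fun h => hi (Int.cast_eq_zero.1 (congrFun h i))

theorem carrier_eq_range_multHom {D : (pow E n).EllipticCurve} {v : Fin n → ℤ}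
    (hD : D.line = Submodule.span ℂ {fun i => (v i : ℂ)}) :
    D.carrier = LinearMap.range (E.multHom v).onPoints := by
  have hlin : ∀ z : ℂ, z • (fun i => (v i : ℂ)) = (E.multHom v).lin z := fun z => by
    ext i
    exact mul_comm _ _
  ext y
  constructor
  · rintro ⟨x, hx, rfl⟩
    change x ∈ D.line at hx
    rw [hD] at hx
    obtain ⟨z, rfl⟩ := Submodule.mem_span_singleton.1 hx
    refine ⟨E.lattice.mkQ z, ?_⟩
    rw [hlin]
    rfl
  · rintro ⟨x, rfl⟩
    obtain ⟨z, rfl⟩ := E.lattice.mkQ_surjective x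
    refine ⟨(E.multHom v).lin z, ?_, rfl⟩
    change _ ∈ D.line
    rw [hD]
    exact Submodule.mem_span_singleton.2 ⟨z, hlin z⟩

theorem isOrdinary_iff {D : (pow E n).EllipticCurve} :
    IsOrdinary D ↔ ∃ v : Fin n → ℤ, v ≠ 0 ∧ D.line = Submodule.span ℂ {fun i => (v i : ℂ)} := by
  constructor
  · rintro ⟨v, hprim, hD⟩
    have hv : v ≠ 0 := by
      rintro rfl
      exact not_isUnit_zero (hprim 0 fun i => dvd_rfl)
    have hr := isRational_span_of_forall_mul_mem (E := E) (a := fun i => (v i : ℂ))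
      fun i z hz => mul_intCast_mem hz (v i)
    refine ⟨v, hv, ?_⟩
    have : D = (pow E n).curveOfVector _ (intCast_ne_zero hv) hr :=
      EllipticCurve.carrier_injective (hD.trans (carrier_eq_range_multHom rfl).symm)
    rw [this]
    rfl
  · rintro ⟨v, hv, hD⟩
    obtain ⟨i₀, hi₀⟩ := Function.ne_iff.1 hv
    obtain ⟨g, hg, hg1⟩ := Finset.extract_gcd v (Finset.univ_nonempty_iff.2 ⟨i₀⟩)
    have hd : Finset.univ.gcd v ≠ 0 := by
      intro h
      exact hi₀ (by rw [hg i₀ (Finset.mem_univ _), h, zero_mul]; rfl)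
    refine ⟨g, fun d hdvd => ?_, carrier_eq_range_multHom ?_⟩
    · have := Finset.dvd_gcd (s := Finset.univ) fun i _ => hdvd i
      rw [hg1] at this
      exact isUnit_of_dvd_one this
    · have hvg : (fun i => (v i : ℂ)) = ((Finset.univ.gcd v : ℤ) : ℂ) • fun i => (g i : ℂ) := by
        ext i
        rw [hg i (Finset.mem_univ i)]
        simp
      rw [hD, hvg, Submodule.span_singleton_smul_eq (IsUnit.mk0 _ (by exact_mod_cast hd))]

/-- If the quotients of the coordinates of the tangent line were all rational, the curve would be
ordinary; so one of them gives a multiplication by a complex number that is not an integer. -/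
theorem hasCM_of_not_isOrdinary {D : (pow E n).EllipticCurve} (hD : ¬ IsOrdinary D) : E.HasCM := by
  obtain ⟨v, hv, hl, hr⟩ := D.exists_line_eq_span
  obtain ⟨i, hi⟩ := Function.ne_iff.1 hv
  rw [Pi.zero_apply] at hi
  obtain ⟨N, hN, h⟩ := hr.exists_mul_div_mem hi
  by_contra hCM
  have hint : ∀ j, ∃ m : ℤ, N * (v j / v i) = m := by
    intro j
    by_contra! hj
    exact hCM ⟨_, fun z hz => by rw [mul_comm]; exact h j z hz, hj⟩
  choose m hm using hint
  have hmv : (fun j => (m j : ℂ)) = (N / v i) • v := by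
    ext j
    rw [← hm, Pi.smul_apply, smul_eq_mul]
    ring
  have hN' : (N : ℂ) ≠ 0 := by exact_mod_cast hN
  refine hD (isOrdinary_iff.2 ⟨m, fun h0 => ?_, ?_⟩)
  · have := hm i
    rw [h0, div_self hi, mul_one] at this
    exact hN' (by simpa using this)
  · rw [hl, hmv, Submodule.span_singleton_smul_eq (IsUnit.mk0 _ (div_ne_zero hN' hi))]

/-- A rational complex multiplication is integral: compare coordinates with respect to a basis
of the lattice. -/
theorem exists_eq_intCast_of_mul_mem {α : ℂ} (hα : ∀ z ∈ E.lattice, α * z ∈ E.lattice) {p q : ℤ}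
    (hq : q ≠ 0) (h : q * α = p) : ∃ k : ℤ, α = k := by
  have := E.discrete
  have : IsZLattice ℝ E.lattice := ⟨E.span_real⟩
  have := ZLattice.module_free ℝ E.lattice
  have : Nontrivial E.lattice := by
    rw [Submodule.nontrivial_iff_ne_bot]
    intro h0
    have h1 := E.span_real
    rw [h0, Submodule.bot_coe, Submodule.span_zero_singleton] at h1
    exact bot_ne_top h1
  let b := Module.Free.chooseBasis ℤ E.lattice
  obtain ⟨i⟩ := b.index_nonempty
  let y : E.lattice := ⟨α * b i, hα _ (b i).2⟩
  have hy : q • y = p • b i := by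
    ext
    simp only [y, Submodule.coe_smul, zsmul_eq_mul]
    rw [← mul_assoc, h]
  have hc := congrArg (fun x => b.repr x i) hy
  simp only [map_smul, Finsupp.smul_apply, b.repr_self, Finsupp.single_eq_same, smul_eq_mul,
    mul_one] at hc
  refine ⟨b.repr y i, mul_left_cancel₀ (by exact_mod_cast hq : (q : ℂ) ≠ 0) ?_⟩
  rw [h, ← hc]
  push_cast
  rfl

/-- The vector `(1, β, 0, …, 0)`. -/
def slopeVector (m : ℕ) (β : ℂ) : Fin (m + 2) → ℂ := Fin.cons 1 (Fin.cons β 0)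

theorem slopeVector_ne_zero (m : ℕ) (β : ℂ) : slopeVector m β ≠ 0 := fun h =>
  one_ne_zero (congrFun h 0)

theorem isRational_span_slopeVector {m : ℕ} {β : ℂ} (hβ : ∀ z ∈ E.lattice, β * z ∈ E.lattice) :
    (pow E (m + 2)).IsRational (Submodule.span ℂ {slopeVector m β}) := by
  refine isRational_span_of_forall_mul_mem fun i z hz => ?_
  refine Fin.cases ?_ (fun i => Fin.cases ?_ (fun i => ?_) i) i
  · simpa [slopeVector] using hz
  · simpa [slopeVector, mul_comm] using hβ z hz
  · simp [slopeVector]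

theorem add_intCast_mul_mem {α : ℂ} (hα : ∀ z ∈ E.lattice, α * z ∈ E.lattice) (k : ℤ) :
    ∀ z ∈ E.lattice, (α + k) * z ∈ E.lattice := by
  intro z hz
  rw [add_mul]
  exact E.lattice.add_mem (hα z hz) (by rw [mul_comm]; exact mul_intCast_mem hz k)

/-- The curves with tangent vectors `(1, α + k, 0, …, 0)`, `k ∈ ℤ`, for a complex multiplication
`α`, which is allowed to be an integer. -/
noncomputable def slopeCurve {α : ℂ} (hα : ∀ z ∈ E.lattice, α * z ∈ E.lattice) (m : ℕ) (k : ℤ) :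
    (pow E (m + 2)).EllipticCurve :=
  (pow E (m + 2)).curveOfVector (slopeVector m (α + k)) (slopeVector_ne_zero _ _)
    (isRational_span_slopeVector (add_intCast_mul_mem hα k))

theorem slopeCurve_injective {α : ℂ} (hα : ∀ z ∈ E.lattice, α * z ∈ E.lattice) (m : ℕ) :
    Function.Injective (slopeCurve hα m) := by
  intro k l h
  have h1 : slopeVector m (α + k) ∈ Submodule.span ℂ {slopeVector m (α + l)} := by
    have : (slopeCurve hα m k).line = (slopeCurve hα m l).line := by rw [h]
    change Submodule.span ℂ {slopeVector m (α + k)} = Submodule.span ℂ {slopeVector m (α + l)}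
      at this
    rw [← this]
    exact Submodule.mem_span_singleton_self _
  obtain ⟨c, hc⟩ := Submodule.mem_span_singleton.1 h1
  have hc0 : c * 1 = 1 := congrFun hc 0
  have hc1 : c * (α + l) = α + k := congrFun hc 1
  rw [mul_one] at hc0
  rw [hc0, one_mul, add_right_inj] at hc1
  exact_mod_cast hc1.symm

theorem infinite_ordinaryCurves {m : ℕ} {A : ComplexTorus V} (g : Hom (pow E (m + 2)) A)
    (hg : Function.Injective g.lin) : (ordinaryCurves g).Infinite := by
  have h0 : ∀ z ∈ E.lattice, (0 : ℂ) * z ∈ E.lattice := fun z _ => by simp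
  refine Set.infinite_of_injective_forall_mem
    ((EllipticCurve.map_injective g hg).comp (slopeCurve_injective h0 m)) fun k => ?_
  refine ⟨slopeCurve h0 m k, isOrdinary_iff.2 ⟨Fin.cons 1 (Fin.cons k 0), ?_, ?_⟩,
    EllipticCurve.carrier_map _ g hg⟩
  · exact fun h => one_ne_zero (congrFun h 0)
  · change Submodule.span ℂ {slopeVector m (0 + k)} = _
    congr 2
    ext i
    refine Fin.cases ?_ (fun i => Fin.cases ?_ (fun i => ?_) i) i <;> simp [slopeVector]

theorem HasCM.infinite_extraordinaryCurves (hE : E.HasCM) {m : ℕ} {A : ComplexTorus V}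
    (g : Hom (pow E (m + 2)) A) (hg : Function.Injective g.lin) :
    (extraordinaryCurves g).Infinite := by
  obtain ⟨α, hα, hne⟩ := hE
  refine Set.infinite_of_injective_forall_mem
    ((EllipticCurve.map_injective g hg).comp (slopeCurve_injective hα m)) fun k => ?_
  refine ⟨slopeCurve hα m k, fun hord => ?_, EllipticCurve.carrier_map _ g hg⟩
  obtain ⟨v, hv, hl⟩ := isOrdinary_iff.1 hord
  have h1 : (fun i => (v i : ℂ)) ∈ Submodule.span ℂ {slopeVector m (α + k)} := by
    change Submodule.span ℂ {slopeVector m (α + k)} = _ at hl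
    rw [hl]
    exact Submodule.mem_span_singleton_self _
  obtain ⟨c, hc⟩ := Submodule.mem_span_singleton.1 h1
  have hc0 : c * 1 = v 0 := congrFun hc 0
  have hc1 : c * (α + k) = v 1 := congrFun hc 1
  rw [mul_one] at hc0
  have hv0 : v 0 ≠ 0 := by
    intro h0
    rw [h0, Int.cast_zero] at hc0
    refine hv (funext fun i => ?_)
    have := congrFun hc i
    rw [hc0, zero_smul] at this
    exact Int.cast_eq_zero.1 this.symm
  obtain ⟨l, hl⟩ := exists_eq_intCast_of_mul_mem hα (p := v 1 - v 0 * k) hv0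
    (by push_cast; rw [← hc1, ← hc0]; ring)
  exact hne l hl

theorem nonempty_extraordinaryCurves_iff {m : ℕ} {A : ComplexTorus V}
    (g : Hom (pow E (m + 2)) A) (hg : Function.Injective g.lin) :
    (extraordinaryCurves g).Nonempty ↔ E.HasCM :=
  ⟨fun ⟨_, _, hD, _⟩ => hasCM_of_not_isOrdinary hD,
    fun h => (h.infinite_extraordinaryCurves g hg).nonempty⟩

theorem infinite_extraordinaryCurves_iff {m : ℕ} {A : ComplexTorus V}
    (g : Hom (pow E (m + 2)) A) (hg : Function.Injective g.lin) :
    (extraordinaryCurves g).Infinite ↔ E.HasCM :=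
  ⟨fun h => (nonempty_extraordinaryCurves_iff g hg).1 h.nonempty,
    fun h => h.infinite_extraordinaryCurves g hg⟩

theorem inclSq_lin_injective (E E' : ComplexTorus ℂ) : Function.Injective (inclSq E E').lin := by
  intro x y h
  ext i
  fin_cases i
  exacts [congrFun h 0, congrFun h 1]

end Powers

section Counting

variable {V : Type*} [NormedAddCommGroup V] [NormedSpace ℂ V] {A : ComplexTorus V}

/-! ### Counting elliptic curves -/

theorem Polarization.form_self_re_nonneg (P : A.Polarization) (x : V) : 0 ≤ (P.form x x).re := by
  by_cases hx : x = 0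
  · simp [hx]
  · exact (P.pos x hx).le

theorem Polarization.form_smul_self_re (P : A.Polarization) (c : ℂ) (x : V) :
    (P.form (c • x) (c • x)).re = Complex.normSq c * (P.form x x).re := by
  rw [P.form_smul_smul, Complex.mul_conj, Complex.re_ofReal_mul]

theorem Polarization.form_smul_right (P : A.Polarization) (c : ℂ) (x y : V) :
    P.form x (c • y) = (starRingEnd ℂ) c * P.form x y := by
  rw [LinearMap.map_smulₛₗ, smul_eq_mul]

theorem Polarization.form_im_sq_le (P : A.Polarization) (x y : V) :
    (P.form x y).im ^ 2 ≤ (P.form x x).re * (P.form y y).re := by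
  -- the form is non-negative at `x + r i y` for all real `r`
  have h : ∀ r : ℝ, 0 ≤ (P.form y y).re * (r * r) + 2 * (P.form x y).im * r + (P.form x x).re := by
    intro r
    have h1 := P.form_self_re_nonneg (x + ((r : ℂ) * Complex.I) • y)
    have h2 : (P.form y x).im = -(P.form x y).im := by rw [P.hermitian x y, Complex.conj_im]
    have h3 : P.form (((r : ℂ) * Complex.I) • y) x = ((r : ℂ) * Complex.I) * P.form y x := by
      rw [map_smul, LinearMap.smul_apply, smul_eq_mul]
    rw [map_add, map_add, LinearMap.add_apply, LinearMap.add_apply, P.form_smul_smul,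
      P.form_smul_right, h3] at h1
    simp [h2] at h1
    linarith
  have h4 := discrim_le_zero h
  rw [discrim] at h4
  linarith

/-- The lattice vectors of bounded length embed in a box of integral vectors, by the alternating
form with a basis of the lattice. -/
theorem Polarization.exists_ncard_lattice_le [FiniteDimensional ℂ V] (P : A.Polarization) :
    ∃ K : ℝ, 0 ≤ K ∧ ∀ B : ℝ, 0 ≤ B → {x | x ∈ A.lattice ∧ (P.form x x).re ≤ B}.Finite ∧
      ({x | x ∈ A.lattice ∧ (P.form x x).re ≤ B}.ncard : ℝ) ≤
        (2 * √(K * B) + 1) ^ (2 * Module.finrank ℂ V) := by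
  classical
  have : FiniteDimensional ℝ V := FiniteDimensional.complexToReal V
  have := A.discrete
  have : IsZLattice ℝ A.lattice := ⟨A.span_real⟩
  have := ZLattice.module_free ℝ A.lattice
  have := ZLattice.module_finite ℝ A.lattice
  let b := Module.finBasis ℤ A.lattice
  have hrank : Module.finrank ℤ A.lattice = 2 * Module.finrank ℂ V := by
    rw [ZLattice.rank ℝ, finrank_real_of_complex]
  have hint : ∀ x : V, ∀ i, ∃ m : ℤ, x ∈ A.lattice → (P.form x (b i)).im = m := by
    intro x i
    by_cases hx : x ∈ A.lattice
    · obtain ⟨m, hm⟩ := P.integral x hx _ (b i).2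
      exact ⟨m, fun _ => hm⟩
    · exact ⟨0, fun h => absurd h hx⟩
  choose Φ hΦ using hint
  have hinj : Set.InjOn Φ A.lattice := by
    intro x hx y hy hxy
    set u := x - y
    have hzero : ∀ z ∈ A.lattice, (P.form u z).im = 0 := by
      intro z hz
      have hz' := congrArg Subtype.val (b.sum_repr ⟨z, hz⟩)
      simp only [Submodule.coe_sum, Submodule.coe_smul] at hz'
      rw [← hz', map_sum, Complex.im_sum]
      refine Finset.sum_eq_zero fun i _ => ?_
      rw [map_zsmul, map_sub, LinearMap.sub_apply, zsmul_eq_mul, ← Complex.ofReal_intCast,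
        Complex.im_ofReal_mul, Complex.sub_im, hΦ x i hx, hΦ y i hy, hxy, sub_self, mul_zero]
    have hall : ∀ z : V, (P.form u z).im = 0 := by
      intro z
      have hz : z ∈ Submodule.span ℝ (A.lattice : Set V) := by rw [A.span_real]; trivial
      induction hz using Submodule.span_induction with
      | mem z hz => exact hzero z hz
      | zero => simp
      | add z z' _ _ h h' => rw [map_add, Complex.add_im, h, h', add_zero]
      | smul r z _ h =>
        rw [← Complex.coe_smul, P.form_smul_right, Complex.conj_ofReal, Complex.im_ofReal_mul, h,
          mul_zero]
    have hI := hall (Complex.I • u)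
    rw [P.form_smul_right] at hI
    by_contra hne
    have hpos := P.pos u (sub_ne_zero.2 hne)
    simp at hI
    linarith
  refine ⟨∑ i, (P.form (b i : V) (b i)).re,
    Finset.sum_nonneg fun i _ => P.form_self_re_nonneg _, fun B hB => ?_⟩
  set K := ∑ i, (P.form (b i : V) (b i)).re with hK
  set m : ℕ := ⌊√(K * B)⌋₊ with hm
  set box := Fintype.piFinset fun _ : Fin (Module.finrank ℤ A.lattice) =>
    Finset.Icc (-(m : ℤ)) m with hbox
  have hmaps : ∀ x ∈ {x | x ∈ A.lattice ∧ (P.form x x).re ≤ B}, Φ x ∈ (box : Set _) := by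
    rintro x ⟨hx, hxB⟩
    rw [Finset.mem_coe, Fintype.mem_piFinset]
    intro i
    have hKi : (P.form (b i : V) (b i)).re ≤ K :=
      Finset.single_le_sum (f := fun i => (P.form (b i : V) (b i)).re)
        (fun i _ => P.form_self_re_nonneg _) (Finset.mem_univ i)
    have h1 : ((Φ x i : ℤ) : ℝ) ^ 2 ≤ K * B := by
      rw [← hΦ x i hx]
      refine (P.form_im_sq_le x (b i)).trans ?_
      rw [mul_comm K B]
      exact mul_le_mul hxB hKi (P.form_self_re_nonneg _) hB
    have h2 : (((Φ x i).natAbs : ℕ) : ℝ) ≤ √(K * B) := by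
      rw [Nat.cast_natAbs, Int.cast_abs]
      exact Real.abs_le_sqrt h1
    have h3 : (Φ x i).natAbs ≤ m := Nat.le_floor h2
    rw [Finset.mem_Icc]
    omega
  have hinj' : Set.InjOn Φ {x | x ∈ A.lattice ∧ (P.form x x).re ≤ B} :=
    hinj.mono fun x hx => hx.1
  refine ⟨Set.Finite.of_finite_image (box.finite_toSet.subset (Set.image_subset_iff.2 hmaps)) hinj',
    ?_⟩
  have hle := Set.ncard_le_ncard_of_injOn Φ hmaps hinj' box.finite_toSet
  rw [Set.ncard_coe_finset, hbox, Fintype.card_piFinset, Finset.prod_const, Finset.card_univ,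
    Fintype.card_fin, hrank, Int.card_Icc] at hle
  have hside : ((((m : ℤ) + 1 - -(m : ℤ)).toNat : ℕ) : ℝ) ≤ 2 * √(K * B) + 1 := by
    have : ((m : ℤ) + 1 - -(m : ℤ)).toNat = 2 * m + 1 := by omega
    rw [this]
    push_cast
    linarith [Nat.floor_le (Real.sqrt_nonneg (K * B))]
  calc _ ≤ (((((m : ℤ) + 1 - -(m : ℤ)).toNat ^ (2 * Module.finrank ℂ V) : ℕ)) : ℝ) := by
        exact_mod_cast hle
    _ ≤ _ := by
        push_cast
        exact pow_le_pow_left₀ (Nat.cast_nonneg _) hside _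

/-- Lattice reduction: the lattice of an elliptic curve of degree `d` contains a vector with
`0 < H(x, x) ≤ 2 d`. -/
theorem EllipticCurve.exists_short_vector [FiniteDimensional ℂ V] (P : A.Polarization)
    (C : A.EllipticCurve) :
    ∃ x ∈ A.lattice, x ≠ 0 ∧ C.line = Submodule.span ℂ {x} ∧ (P.form x x).re ≤ 2 * C.degree P := by
  obtain ⟨b⟩ := C.exists_basis
  obtain ⟨v, hv, hl, -⟩ := C.exists_line_eq_span
  set d := C.degree P with hd
  have hdpos : 0 < d := by
    rw [hd, C.degree_eq P b]
    exact abs_pos.2 (C.form_basis_im_ne_zero P b)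
  -- pairs of lattice vectors that span a parallelogram of area `d`
  let S : Set V := {x | x ∈ C.lattice ∧ ∃ y ∈ C.lattice, |(P.form x y).im| = d}
  have hb : (b 0 : V) ∈ S := ⟨(b 0).2, b 1, (b 1).2, (C.degree_eq P b).symm⟩
  obtain ⟨K, hK, hcount⟩ := P.exists_ncard_lattice_le
  obtain ⟨x, ⟨hxS, hxb⟩, hmin⟩ := Set.exists_min_image
    (S ∩ {x | (P.form x x).re ≤ (P.form (b 0 : V) (b 0)).re}) (fun x => (P.form x x).re)
    ((hcount _ (P.form_self_re_nonneg _)).1.subset fun x hx => ⟨hx.1.1.1, hx.2⟩)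
    ⟨b 0, hb, le_refl (P.form (b 0 : V) (b 0)).re⟩
  have hmin' : ∀ y ∈ S, (P.form x x).re ≤ (P.form y y).re := by
    intro y hy
    by_cases h : (P.form y y).re ≤ (P.form (b 0 : V) (b 0)).re
    · exact hmin y ⟨hy, h⟩
    · exact hxb.trans (not_le.1 h).le
  obtain ⟨hx, y, hy, hxy⟩ := hxS
  have hx0 : x ≠ 0 := by
    rintro rfl
    rw [map_zero, LinearMap.zero_apply, Complex.zero_im, abs_zero] at hxy
    exact hdpos.ne hxy
  have hspan : C.line = Submodule.span ℂ {x} := by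
    have hxl : x ∈ C.line := hx.2
    rw [hl] at hxl ⊢
    obtain ⟨c, rfl⟩ := Submodule.mem_span_singleton.1 hxl
    rw [Submodule.span_singleton_smul_eq (IsUnit.mk0 _ (left_ne_zero_of_smul hx0))]
  refine ⟨x, hx.1, hx0, hspan, ?_⟩
  have hyl : y ∈ C.line := hy.2
  rw [hspan] at hyl
  obtain ⟨c, rfl⟩ := Submodule.mem_span_singleton.1 hyl
  have hq := P.pos x hx0
  have harea : |c.im| * (P.form x x).re = d := by
    rw [← hxy, P.form_smul_right, Complex.mul_im, P.form_self_im, mul_zero, zero_add,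
      Complex.conj_im, abs_mul, abs_neg, abs_of_pos hq]
  -- subtract a multiple of `x` from the second vector and compare its length with that of `x`
  set k := round c.re
  have hk : (c - k) • x ∈ S := by
    refine ⟨?_, x, hx, ?_⟩
    · rw [sub_smul, Int.cast_smul_eq_zsmul]
      exact C.lattice.sub_mem hy (C.lattice.smul_mem k hx)
    · rw [map_smul, LinearMap.smul_apply, smul_eq_mul, Complex.mul_im, P.form_self_im, mul_zero,
        zero_add, abs_mul, abs_of_pos hq, ← harea]
      simp
  have h1 := hmin' _ hk
  rw [P.form_smul_self_re] at h1
  have h2 : 1 ≤ Complex.normSq (c - k) := le_of_mul_le_mul_right (by rwa [one_mul]) hq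
  rw [Complex.normSq_apply] at h2
  simp only [Complex.sub_re, Complex.intCast_re, Complex.sub_im, Complex.intCast_im, sub_zero] at h2
  have h3 := abs_sub_round c.re
  have h4 : (c.re - k) * (c.re - k) ≤ 1 / 4 := by
    have := abs_le.1 h3
    nlinarith
  have h5 : 1 / 2 ≤ |c.im| := by
    by_contra! h
    have := abs_lt.1 h
    nlinarith
  nlinarith

/-- Assigning to each curve a short vector of its lattice, which determines the curve, bounds the
number of curves by a number of lattice vectors. -/
theorem Polarization.finite_curvesOfDegreeLE [FiniteDimensional ℂ V] (P : A.Polarization) :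
    ∃ K : ℝ, 0 ≤ K ∧ ∀ t : ℝ, (A.curvesOfDegreeLE P t).Finite ∧
      (0 ≤ t → (A.curveCount P t : ℝ) ≤ (2 * √(K * t) + 1) ^ (2 * Module.finrank ℂ V)) := by
  obtain ⟨K, hK, hcount⟩ := P.exists_ncard_lattice_le
  choose x hx hx0 hxl hxq using EllipticCurve.exists_short_vector (A := A) P
  have hinj : Function.Injective x := fun C D h => EllipticCurve.ext_line (by rw [hxl C, hxl D, h])
  have hmaps : ∀ t, ∀ C ∈ A.curvesOfDegreeLE P t,
      x C ∈ {x | x ∈ A.lattice ∧ (P.form x x).re ≤ 2 * t} := by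
    intro t C hC
    have hC' : C.degree P ≤ t := hC
    exact ⟨hx C, by linarith [hxq C]⟩
  refine ⟨K * 2, by positivity, fun t => ?_⟩
  rcases le_or_gt 0 t with ht | ht
  · obtain ⟨hfin, hle⟩ := hcount (2 * t) (by positivity)
    refine ⟨Set.Finite.of_finite_image (hfin.subset (Set.image_subset_iff.2 (hmaps t)))
      hinj.injOn, fun _ => ?_⟩
    rw [mul_assoc]
    refine le_trans ?_ hle
    exact_mod_cast Set.ncard_le_ncard_of_injOn x (hmaps t) hinj.injOn hfin
  · refine ⟨?_, fun h => absurd ht (not_lt.2 h)⟩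
    convert Set.finite_empty
    refine Set.eq_empty_of_forall_notMem fun C hC => ?_
    have := (hmaps t C hC).2
    linarith [P.form_self_re_nonneg (x C)]

/-- The number of elliptic curves of degree at most `t` is `O(t ^ g)`, where `g` is the dimension:
the short vectors of the curves are lattice points in a ball of radius `O(√t)` in a real space of
dimension `2 g`. -/
theorem Polarization.curveCount_isBigO [FiniteDimensional ℂ V] (P : A.Polarization) {m : ℕ}
    (hm : Module.finrank ℂ V ≤ m) :
    (fun t : ℝ => (A.curveCount P t : ℝ)) =O[atTop] fun t => t ^ m := by
  obtain ⟨K, hK, hcount⟩ := P.finite_curvesOfDegreeLE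
  refine IsBigO.of_bound ((2 * √K + 1) ^ (2 * Module.finrank ℂ V)) ?_
  filter_upwards [eventually_ge_atTop 1] with t ht
  have ht0 : (0 : ℝ) ≤ t := by linarith
  rw [Real.norm_of_nonneg (Nat.cast_nonneg _), Real.norm_of_nonneg (pow_nonneg ht0 _)]
  have hs : 1 ≤ √t := Real.one_le_sqrt.2 ht
  calc (A.curveCount P t : ℝ) ≤ (2 * √(K * t) + 1) ^ (2 * Module.finrank ℂ V) :=
        (hcount t).2 ht0
    _ ≤ ((2 * √K + 1) * √t) ^ (2 * Module.finrank ℂ V) := by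
        refine pow_le_pow_left₀ (by positivity) ?_ _
        rw [Real.sqrt_mul hK]
        linarith
    _ = (2 * √K + 1) ^ (2 * Module.finrank ℂ V) * t ^ Module.finrank ℂ V := by
        rw [mul_pow, pow_mul (√t), Real.sq_sqrt ht0]
    _ ≤ _ := by gcongr

end Counting

section Main

variable {V : Type*} [NormedAddCommGroup V] [NormedSpace ℂ V] [FiniteDimensional ℂ V]
  {A : ComplexTorus V}

/-! ### Polarized Abelian surfaces and threefolds -/

theorem Polarization.exists_complementary_curve (P : A.Polarization)
    (hn : Module.finrank ℂ V = 2) (C : A.EllipticCurve) :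
    ∃ (C' : A.EllipticCurve) (E : Fin 2 → ComplexTorus ℂ) (f : Hom (pi E) A), f.IsIsogeny ∧
      EmbedsFactorOnto f 0 C ∧ EmbedsFactorOnto f 1 C' ∧ HasProductPullback f P := by
  obtain ⟨v, hv, hl, hr⟩ := C.exists_line_eq_span
  obtain ⟨u, hu⟩ := P.exists_orthogonalFrame_two hn hv hr
  obtain ⟨E, f, hf, hemb, hprod⟩ :=
    A.exists_isogeny_of_linearIndependent hu.linearIndependent hu.isRational hn
  exact ⟨A.curveOfVector u (hu.ne_zero 1) (hu.isRational 1), E, f, hf, hemb 0 C hl, hemb 1 _ rfl,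
    hprod P hu.orthogonal⟩

/-- If `A` contains three elliptic curves, the factors of an orthogonal decomposition are isogenous,
so that one of them can be substituted for the other. -/
theorem Polarization.exists_isogeny_sq (P : A.Polarization) (hn : Module.finrank ℂ V = 2)
    (hcard : 3 ≤ ENat.card A.EllipticCurve) :
    ∃ (E : ComplexTorus ℂ) (f : Hom (E.pow 2) A), f.IsIsogeny ∧ HasProductPullback f P := by
  have hpos : ENat.card A.EllipticCurve ≠ 0 := fun h => by simp [h] at hcard
  obtain ⟨C⟩ : Nonempty A.EllipticCurve := by
    by_contra h
    exact hpos (ENat.card_eq_zero_iff_empty _ |>.2 (not_nonempty_iff.1 h))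
  obtain ⟨v, hv, hl, hr⟩ := C.exists_line_eq_span
  obtain ⟨u, hu⟩ := P.exists_orthogonalFrame_two hn hv hr
  obtain ⟨f, hf, -⟩ := hu.exists_isogeny (Equiv.refl _) (fun i => Isogenous.refl _)
  obtain ⟨i, j, hij, h⟩ := exists_isogenous_of_lt_card hf (lt_of_lt_of_le (by norm_num) hcard)
  refine ⟨A.lineTorus _ (hu.ne_zero i) (hu.isRational i),
    hu.exists_isogeny (Equiv.refl _) fun k => ?_⟩
  have hk : k = i ∨ k = j := by omega
  rcases hk with rfl | rfl
  exacts [Isogenous.refl _, h]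

theorem Polarization.exists_isogeny_of_ne (P : A.Polarization) (hn : Module.finrank ℂ V = 3)
    {C C' : A.EllipticCurve} (hne : C ≠ C') :
    (∃ (C'' : A.EllipticCurve) (E : Fin 3 → ComplexTorus ℂ) (f : Hom (pi E) A), f.IsIsogeny ∧
      EmbedsFactorOnto f 0 C ∧ EmbedsFactorOnto f 1 C' ∧ EmbedsFactorOnto f 2 C'') ∧
    (∃ (C₁ C₂ : A.EllipticCurve) (E : Fin 3 → ComplexTorus ℂ) (f : Hom (pi E) A), f.IsIsogeny ∧
      EmbedsFactorOnto f 0 C ∧ EmbedsFactorOnto f 1 C₁ ∧ EmbedsFactorOnto f 2 C₂ ∧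
      HasProductPullback f P) := by
  obtain ⟨v, hv, hl, hr⟩ := C.exists_line_eq_span
  obtain ⟨v', hv', hl', hr'⟩ := C'.exists_line_eq_span
  have hmem := EllipticCurve.notMem_span_of_ne hne hv' hl hl'
  obtain ⟨u₁, u₂, hu, hperp⟩ := P.exists_orthogonalFrame_three hn hv hmem hr hr'
  have hu₂ : u₂ ≠ 0 := hu.ne_zero 2
  constructor
  · have hindep : LinearIndependent ℂ ![v, v', u₂] := by
      rw [Fintype.linearIndependent_iff]
      intro c hc
      simp only [Fin.sum_univ_three, Matrix.cons_val_zero, Matrix.cons_val_one,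
        Matrix.cons_val_two, Matrix.head_cons, Matrix.tail_cons] at hc
      have hvu₂ : P.form v u₂ = 0 := hu.orthogonal 0 2 (by decide)
      have h2 : c 2 = 0 := by
        have := congrArg (fun x => P.form x u₂) hc
        simpa [hvu₂, hperp, P.form_self_ne_zero hu₂] using this
      rw [h2, zero_smul, add_zero] at hc
      have h1 : c 1 = 0 := by
        by_contra h1
        refine hmem ?_
        rw [← Submodule.smul_mem_iff _ h1, ← neg_eq_of_add_eq_zero_right hc]
        exact Submodule.neg_mem _ (Submodule.mem_span_singleton.2 ⟨_, rfl⟩)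
      rw [h1, zero_smul, add_zero] at hc
      have h0 := (smul_eq_zero.1 hc).resolve_right hv
      intro i
      fin_cases i <;> assumption
    have hr₂ : A.IsRational (Submodule.span ℂ {u₂}) := hu.isRational 2
    obtain ⟨E, f, hf, hemb, -⟩ := A.exists_isogeny_of_linearIndependent hindep
      (by simp [Fin.forall_fin_succ, hr, hr', hr₂]) hn
    exact ⟨A.curveOfVector u₂ hu₂ hr₂, E, f, hf, hemb 0 C hl, hemb 1 C' hl', hemb 2 _ rfl⟩
  · obtain ⟨E, f, hf, hemb, hprod⟩ :=
      A.exists_isogeny_of_linearIndependent hu.linearIndependent hu.isRational hn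
    exact ⟨A.curveOfVector u₁ (hu.ne_zero 1) (hu.isRational 1),
      A.curveOfVector u₂ hu₂ (hu.isRational 2), E, f, hf, hemb 0 C hl, hemb 1 _ rfl,
      hemb 2 _ rfl, hprod P hu.orthogonal⟩

/-- As for surfaces, two factors of an orthogonal decomposition are isogenous; the first alternative
holds if the third one is isogenous to them. -/
theorem Polarization.exists_isogeny_cube_or (P : A.Polarization) (hn : Module.finrank ℂ V = 3)
    (hcard : 4 ≤ ENat.card A.EllipticCurve) :
    (∃ (E : ComplexTorus ℂ) (f : Hom (E.pow 3) A), f.IsIsogeny ∧ HasProductPullback f P) ∨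
      ∃ (E E' : ComplexTorus ℂ) (f : Hom (pi ![E, E, E']) A),
        ¬ E.Isogenous E' ∧ f.IsIsogeny ∧ HasProductPullback f P := by
  obtain ⟨C, C', hne⟩ : ∃ C C' : A.EllipticCurve, C ≠ C' := by
    by_contra! h
    have : Subsingleton A.EllipticCurve := ⟨h⟩
    have h1 := hcard.trans (ENat.card_le_one_iff_subsingleton _ |>.2 this)
    norm_num at h1
  obtain ⟨v, hv, hl, hr⟩ := C.exists_line_eq_span
  obtain ⟨v', hv', hl', hr'⟩ := C'.exists_line_eq_span
  have hmem := EllipticCurve.notMem_span_of_ne hne hv' hl hl'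
  obtain ⟨u₁, u₂, hu, -⟩ := P.exists_orthogonalFrame_three hn hv hmem hr hr'
  obtain ⟨f, hf, -⟩ := hu.exists_isogeny (Equiv.refl _) (fun i => Isogenous.refl _)
  obtain ⟨i, j, hij, h⟩ := exists_isogenous_of_lt_card hf (lt_of_lt_of_le (by norm_num) hcard)
  have hperm : ∀ i j : Fin 3, i ≠ j → ∃ σ : Equiv.Perm (Fin 3), σ 0 = i ∧ σ 1 = j := by decide
  obtain ⟨σ, rfl, rfl⟩ := hperm i j hij
  set T : Fin 3 → ComplexTorus ℂ := fun i => A.lineTorus _ (hu.ne_zero i) (hu.isRational i)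
  by_cases hT : (T (σ 0)).Isogenous (T (σ 2))
  · refine Or.inl ⟨T (σ 0), hu.exists_isogeny σ fun k => ?_⟩
    fin_cases k
    exacts [Isogenous.refl _, h, hT]
  · obtain ⟨f, hf, hfP⟩ := hu.exists_isogeny σ (F := ![T (σ 0), T (σ 0), T (σ 2)]) fun k => by
      fin_cases k
      exacts [Isogenous.refl _, h, Isogenous.refl _]
    exact Or.inr ⟨_, _, f, hT, hf, hfP⟩

end Main

end ComplexTorus

theorem mainTheorem9 {V : Type*} [NormedAddCommGroup V] [NormedSpace ℂ V]
    [FiniteDimensional ℂ V] (A : ComplexTorus V) (P : A.Polarization) :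
    -- polarized Abelian surfaces
    (Module.finrank ℂ V = 2 →
      -- the counting function
      ((∀ t : ℝ, (A.curvesOfDegreeLE P t).Finite) ∧
        (fun t : ℝ => (A.curveCount P t : ℝ)) =O[atTop] fun t => t ^ 3) ∧
      -- a curve has a complementary curve
      (∀ C : A.EllipticCurve, ∃ (C' : A.EllipticCurve) (E : Fin 2 → ComplexTorus ℂ)
        (f : ComplexTorus.Hom (ComplexTorus.pi E) A), f.IsIsogeny ∧
          ComplexTorus.EmbedsFactorOnto f 0 C ∧ ComplexTorus.EmbedsFactorOnto f 1 C' ∧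
          ComplexTorus.HasProductPullback f P) ∧
      -- at least three curves
      (3 ≤ ENat.card A.EllipticCurve →
        (∀ (E : Fin 2 → ComplexTorus ℂ) (f : ComplexTorus.Hom (ComplexTorus.pi E) A),
          f.IsIsogeny → (E 0).Isogenous (E 1)) ∧
        ∃ (E : ComplexTorus ℂ) (f : ComplexTorus.Hom (E.pow 2) A), f.IsIsogeny ∧
          ComplexTorus.HasProductPullback f P) ∧
      -- ordinary and extra-ordinary curves
      (∀ (E : ComplexTorus ℂ) (f : ComplexTorus.Hom (E.pow 2) A), f.IsIsogeny →
        (ComplexTorus.ordinaryCurves f).Infinite ∧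
        ((ComplexTorus.extraordinaryCurves f).Nonempty ↔ E.HasCM) ∧
        ((ComplexTorus.extraordinaryCurves f).Infinite ↔ E.HasCM))) ∧
    -- polarized Abelian threefolds
    (Module.finrank ℂ V = 3 →
      -- the counting function
      ((∀ t : ℝ, (A.curvesOfDegreeLE P t).Finite) ∧
        (fun t : ℝ => (A.curveCount P t : ℝ)) =O[atTop] fun t => t ^ 5) ∧
      -- at least two curves
      (∀ C C' : A.EllipticCurve, C ≠ C' →
        (∃ (C'' : A.EllipticCurve) (E : Fin 3 → ComplexTorus ℂ)
          (f : ComplexTorus.Hom (ComplexTorus.pi E) A), f.IsIsogeny ∧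
            ComplexTorus.EmbedsFactorOnto f 0 C ∧ ComplexTorus.EmbedsFactorOnto f 1 C' ∧
            ComplexTorus.EmbedsFactorOnto f 2 C'') ∧
        (∃ (C₁ C₂ : A.EllipticCurve) (E : Fin 3 → ComplexTorus ℂ)
          (f : ComplexTorus.Hom (ComplexTorus.pi E) A), f.IsIsogeny ∧
            ComplexTorus.EmbedsFactorOnto f 0 C ∧ ComplexTorus.EmbedsFactorOnto f 1 C₁ ∧
            ComplexTorus.EmbedsFactorOnto f 2 C₂ ∧
            ComplexTorus.HasProductPullback f P)) ∧
      -- at least four curves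
      (4 ≤ ENat.card A.EllipticCurve →
        (∀ (E : Fin 3 → ComplexTorus ℂ) (f : ComplexTorus.Hom (ComplexTorus.pi E) A),
          f.IsIsogeny → ∃ i j : Fin 3, i ≠ j ∧ (E i).Isogenous (E j)) ∧
        ((∃ (E : ComplexTorus ℂ) (f : ComplexTorus.Hom (E.pow 3) A), f.IsIsogeny ∧
            ComplexTorus.HasProductPullback f P) ∨
          ∃ (E E' : ComplexTorus ℂ) (f : ComplexTorus.Hom (ComplexTorus.pi ![E, E, E']) A),
            ¬ E.Isogenous E' ∧ f.IsIsogeny ∧ ComplexTorus.HasProductPullback f P)) ∧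
      -- ordinary and extra-ordinary curves, for an isogeny from `E³`
      (∀ (E : ComplexTorus ℂ) (f : ComplexTorus.Hom (E.pow 3) A), f.IsIsogeny →
        (ComplexTorus.ordinaryCurves f).Infinite ∧
        ((ComplexTorus.extraordinaryCurves f).Nonempty →
          (ComplexTorus.extraordinaryCurves f).Infinite)) ∧
      -- ordinary and extra-ordinary curves, for an isogeny from `E² × E'`
      (∀ (E E' : ComplexTorus ℂ) (f : ComplexTorus.Hom (ComplexTorus.pi ![E, E, E']) A),
        ¬ E.Isogenous E' → f.IsIsogeny →
        (ComplexTorus.ordinaryCurves (f.comp (ComplexTorus.inclSq E E'))).Infinite ∧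
        ((ComplexTorus.extraordinaryCurves (f.comp (ComplexTorus.inclSq E E'))).Nonempty →
          (ComplexTorus.extraordinaryCurves (f.comp (ComplexTorus.inclSq E E'))).Infinite))) := by
  refine ⟨fun hn => ⟨⟨fun t => ?_, P.curveCount_isBigO (by omega)⟩,
    P.exists_complementary_curve hn, fun hcard => ⟨fun E f hf => ?_, P.exists_isogeny_sq hn hcard⟩,
    fun E f hf => ?_⟩, fun hn => ⟨⟨fun t => ?_, P.curveCount_isBigO (by omega)⟩,
    fun C C' hne => P.exists_isogeny_of_ne hn hne,
    fun hcard => ⟨fun E f hf => ?_, P.exists_isogeny_cube_or hn hcard⟩,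
    fun E f hf => ?_, fun E E' f hE hf => ?_⟩⟩
  · obtain ⟨K, -, h⟩ := P.finite_curvesOfDegreeLE
    exact (h t).1
  · obtain ⟨i, j, hij, h⟩ :=
      ComplexTorus.exists_isogenous_of_lt_card hf (lt_of_lt_of_le (by norm_num) hcard)
    fin_cases i <;> fin_cases j
    exacts [absurd rfl hij, h, h.symm, absurd rfl hij]
  · exact ⟨ComplexTorus.infinite_ordinaryCurves (m := 0) f hf.bijective.1,
      ComplexTorus.nonempty_extraordinaryCurves_iff (m := 0) f hf.bijective.1,
      ComplexTorus.infinite_extraordinaryCurves_iff (m := 0) f hf.bijective.1⟩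
  · obtain ⟨K, -, h⟩ := P.finite_curvesOfDegreeLE
    exact (h t).1
  · exact ComplexTorus.exists_isogenous_of_lt_card hf (lt_of_lt_of_le (by norm_num) hcard)
  · have hinj := hf.bijective.1
    exact ⟨ComplexTorus.infinite_ordinaryCurves (m := 1) f hinj, fun h =>
      (ComplexTorus.infinite_extraordinaryCurves_iff (m := 1) f hinj).2
        ((ComplexTorus.nonempty_extraordinaryCurves_iff (m := 1) f hinj).1 h)⟩
  · have hinj : Function.Injective (f.comp (ComplexTorus.inclSq E E')).lin :=
      hf.bijective.1.comp (ComplexTorus.inclSq_lin_injective E E')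
    exact ⟨ComplexTorus.infinite_ordinaryCurves (m := 0) _ hinj, fun h =>
      (ComplexTorus.infinite_extraordinaryCurves_iff (m := 0) _ hinj).2
        ((ComplexTorus.nonempty_extraordinaryCurves_iff (m := 0) _ hinj).1 h)⟩
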